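/- **Conventions.** Spaces are compactly generated Hausdorff, with compactly generated products. A (nonsymmetric) topological operad $\mathscr C$ consists of spaces $\mathscr C(n)$, $n\ge 0$, with $\mathscr C(0)$ a point, continuous maps $\gamma:\mathscr C(k)\times\mathscr C(m_1)\times\cdots\times\mathscr C(m_k)\to\mathscr C(m_1+\cdots+m_k)$ and $1\in\mathscr C(1)$ satisfying the usual associativity and unit laws; a (discrete) operad is the same with sets. $\mathscr C$ is path-connected if every $\mathscr C(n)$ is. Products in $S_n$ are $\sigma\cdot\tau=\tau\circ\sigma$. In the symmetric groups operad $\mathscr S=\{S_n\}$, $\gamma(\sigma;\tau_1,\dots,\tau_k)$ sends the $j$-th letter of the $i$-th block (blocks of sizes $m_1,\dots,m_k$) to the $\tau_i(j)$-th letter of the $\sigma(i)$-th block (blocks of sizes $m_{\sigma^{-1}(1)},\dots,m_{\sigma^{-1}(k)}$). A *group operad* is an operad $\mathscr G=\{G_n\}$ of groups together with a morphism of operads $\pi:\mathscr G\to\mathscr S$ consisting of homomorphisms, such that the identity of $G_1$ is the operad unit and, writing $a(i)=(\pi a)(i)$, $$\gamma(aa';b_1b_1',\dots,b_kb_k')=\gamma(a;b_1,\dots,b_k)\,\gamma(a';b'_{a^{-1}(1)},\dots,b'_{a^{-1}(k)}).$$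 It is *non-crossed* if $\pi$ is trivial. A *$\mathscr G$-operad* is an operad $\mathscr X$ with left actions of $G_n$ on $\mathscr X(n)$ (continuous in the topological case) such that $$\gamma(\sigma a;\tau_1b_1,\dots,\tau_kb_k)=\gamma(\sigma;\tau_1,\dots,\tau_k)\,\gamma(a;b_{\sigma^{-1}(1)},\dots,b_{\sigma^{-1}(k)}).$$ A symmetric operad is an $\mathscr S$-operad; it is *covering* if each $S_n$ acts on $\mathscr C(n)$ by a covering action, i.e. every point has a neighborhood disjoint from its translates by non-identity elements. Let $\mathscr C_1$ be the little intervals operad, $c_k=([0,\frac1k],\dots,[\frac{k-1}k,1])$, $\mathscr C_1(k)_0$ the path component of $c_k$ in $\mathscr C_1(k)$, and $(\mathscr C_1)_0=\{\mathscr C_1(k)_0\}$ the resulting nonsymmetric suboperad. A *good basepoint* of $\mathscr C$ is $e_k=\eta(c_k)$ for a chosen continuous morphism of nonsymmetric operads $\eta:(\mathscr C_1)_0\to\mathscr C$. For $m=m_1+\cdots+m_k$ let $\delta$ be the path from $e_m$ to $\gamma(e_k;e_{m_1},\dots,e_{m_k})$ that is the image under $\eta$ of the linear path from $c_m$ to $\gamma(c_k;c_{m_1},\dots,c_{m_k})$.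 **Theorem.** (1) Let $\mathscr C$ be a path-connected nonsymmetric topological operad with a good basepoint. Let $\pi_l\mathscr C=\{\pi_l(\mathscr C(k),e_k)\}_{k\ge0}$, $l\geq 1$, have as unit the class of the constant map at $e_1=1$, and $$\gamma([f];[g_1],\dots,[g_k])=\delta_*[\gamma(f;g_1,\dots,g_k)],$$ where $\gamma(f;g_1,\dots,g_k)$ is formed pointwise and $\delta_*$ is the change of basepoint along $\delta$; for $l=1$ this is $[\delta][\gamma(f;g_1,\dots,g_k)][\delta]^{-1}$. Then $\pi_1\mathscr C$ is a non-crossed group operad and, for every $l\ge1$, $\pi_l\mathscr C$ with the usual action of $\pi_1(\mathscr C(k),e_k)$ on $\pi_l(\mathscr C(k),e_k)$ is a $\pi_1\mathscr C$-operad. (2) Let $\mathscr C$ be a path-connected covering symmetric topological operad with a good basepoint. Let $L_k$ be the set of pairs consisting of $\sigma\in S_k$ and a homotopy class (relative to the endpoints) of paths in $\mathscr C(k)$ from $e_k$ to $\sigma e_k$. The quotient maps $\mathscr C(k)\to\mathscr C(k)/S_k$ induce bijections $L_k\to\pi_1(\mathscr C(k)/S_k,S_ke_k)$, and bijections $\pi_l(\mathscr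 C(k),e_k)\to\pi_l(\mathscr C(k)/S_k,S_ke_k)$ for $l>1$. Let $\pi_1(\mathscr C/\mathscr S)=\{\pi_1(\mathscr C(k)/S_k,S_ke_k)\}_{k\ge0}$, with $\pi:\pi_1(\mathscr C(k)/S_k,S_ke_k)\to S_k$, $(\sigma,[f])\mapsto\sigma$, with the class of the constant path as unit, and with $\gamma((\sigma,[f]);(\tau_1,[g_1]),\dots,(\tau_k,[g_k]))$ the class over $\gamma(\sigma;\tau_1,\dots,\tau_k)$ of the path $$\delta_1\cdot\gamma(f;g_1,\dots,g_k)\cdot\gamma(\sigma;\tau_1,\dots,\tau_k)\delta_2^{-1},$$ where $\delta_1:e_m\to\gamma(e_k;e_{m_1},\dots,e_{m_k})$ and $\delta_2:e_m\to\gamma(e_k;e_{m_{\sigma^{-1}(1)}},\dots,e_{m_{\sigma^{-1}(k)}})$ are the paths defined above. For $l>1$ let $\pi_l(\mathscr C/\mathscr S)=\{\pi_l(\mathscr C(k)/S_k,S_ke_k)\}_{k\ge0}$ have the operad operations carried over from $\pi_l\mathscr C$ by the bijections. Then $\pi_1(\mathscr C/\mathscr S)$ is a group operad and, for every $l>1$,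 $\pi_l(\mathscr C/\mathscr S)$ with the usual action of $\pi_1(\mathscr C(k)/S_k,S_ke_k)$ on $\pi_l(\mathscr C(k)/S_k,S_ke_k)$ is a $\pi_1(\mathscr C/\mathscr S)$-operad. -/

import Mathlib

open scoped Topology Topology.Homotopy

universe u v

noncomputable section

/-! ### Arity bookkeeping -/

/-- The identification of the `j`-th input of the `i`-th block with an input of the composite:
blocks are concatenated in their natural order. -/
def blk {k N : ℕ} (m : Fin k → ℕ) (h : N = ∑ i, m i) : (Σ i, Fin (m i)) ≃ Fin N :=
  finSigmaFinEquiv.trans (finCongr h.symm)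

theorem blk_lt {k N : ℕ} (m : Fin k → ℕ) (h : N = ∑ i, m i) {i i' : Fin k} (hi : i < i')
    (j : Fin (m i)) (j' : Fin (m i')) : blk m h ⟨i, j⟩ < blk m h ⟨i', j'⟩ := by
  have key : ∀ (r : ℕ) (hr : r ≤ k), (i : ℕ) < r →
      ∑ x : Fin (i : ℕ), m (Fin.castLE i.2.le x) + m i ≤ ∑ x : Fin r, m (Fin.castLE hr x) := by
    intro r
    induction r with
    | zero => intro _ h0; omega
    | succ r ih =>
      intro hr hir
      rw [Fin.sum_univ_castSucc]
      rcases Nat.lt_succ_iff_lt_or_eq.mp hir with h1 | h1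
      · exact (ih (by omega) h1).trans (Nat.le_add_right _ _)
      · subst h1; exact le_rfl
  subst h
  have h1 := finSigmaFinEquiv_apply (n := m) ⟨i, j⟩
  have h2 := finSigmaFinEquiv_apply (n := m) ⟨i', j'⟩
  have h3 := key i' i'.2.le hi
  have h4 := j.2
  change ((finSigmaFinEquiv (n := m) ⟨i, j⟩ : Fin _) : ℕ)
    < ((finSigmaFinEquiv (n := m) ⟨i', j'⟩ : Fin _) : ℕ)
  dsimp only at h1 h2
  omega

theorem blk_lt_iff_snd {k N : ℕ} (m : Fin k → ℕ) (h : N = ∑ i, m i) (i : Fin k)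
    (j j' : Fin (m i)) : blk m h ⟨i, j⟩ < blk m h ⟨i, j'⟩ ↔ j < j' := by
  subst h
  have h1 := finSigmaFinEquiv_apply (n := m) ⟨i, j⟩
  have h2 := finSigmaFinEquiv_apply (n := m) ⟨i, j'⟩
  change ((finSigmaFinEquiv (n := m) ⟨i, j⟩ : Fin _) : ℕ)
    < ((finSigmaFinEquiv (n := m) ⟨i, j'⟩ : Fin _) : ℕ) ↔ (j : ℕ) < j'
  dsimp only at h1 h2
  omega

/-! ### Operads -/

/-- The operations `γ` and the unit of an operad, without axioms.
`comp m h a b` is `γ(a; b₁, …, b_k)`, an element of arity `N = m₁ + ⋯ + m_k`. -/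
structure OperadOps (C : ℕ → Type v) where
  comp : ∀ {k : ℕ} (m : Fin k → ℕ) {N : ℕ}, N = ∑ i, m i → C k → (∀ i, C (m i)) → C N
  one : C 1

/-- The axioms of an operad (in sets) with `C(0)` a single point. -/
structure OperadOps.IsOperad {C : ℕ → Type v} (O : OperadOps C) : Prop where
  zero_unique : Nonempty (Unique (C 0))
  assoc : ∀ {k : ℕ} (m : Fin k → ℕ) {N : ℕ} (h : N = ∑ i, m i)
    (n : Fin N → ℕ) {M : ℕ} (hM : M = ∑ p, n p)
    (s : Fin k → ℕ) (hs : ∀ i, s i = ∑ j, n (blk m h ⟨i, j⟩)) (hM' : M = ∑ i, s i)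
    (a : C k) (b : ∀ i, C (m i)) (c : ∀ p, C (n p)),
    O.comp n hM (O.comp m h a b) c =
      O.comp s hM' a (fun i => O.comp (fun j => n (blk m h ⟨i, j⟩)) (hs i) (b i)
        (fun j => c (blk m h ⟨i, j⟩)))
  one_comp : ∀ {n : ℕ} (h : n = ∑ _i : Fin 1, n) (a : C n),
    O.comp (fun _ : Fin 1 => n) h O.one (fun _ => a) = a
  comp_one : ∀ {k : ℕ} (h : k = ∑ _i : Fin k, 1) (a : C k),
    O.comp (fun _ : Fin k => 1) h a (fun _ => O.one) = a

/-- Transport of operad operations along bijections. -/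
def OperadOps.transport {C : ℕ → Type u} {D : ℕ → Type v} (O : OperadOps C)
    (e : ∀ n, C n ≃ D n) : OperadOps D where
  comp m _ h a b := e _ (O.comp m h ((e _).symm a) (fun i => (e (m i)).symm (b i)))
  one := e 1 O.one

/-! ### The symmetric groups operad, group operads and their actions -/

/-- The symmetric group with product `σ · τ = τ ∘ σ` (first `σ`, then `τ`). As a function, `σ`
is `σ.unop`, and `σ⁻¹(i)` is `σ.unop.symm i`. -/
abbrev SG (n : ℕ) : Type := (Equiv.Perm (Fin n))ᵐᵒᵖ

theorem sum_perm_eq {k N : ℕ} {m : Fin k → ℕ} (h : N = ∑ i, m i) (σ : Equiv.Perm (Fin k)) :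
    N = ∑ i, m (σ.symm i) :=
  h.trans (Equiv.sum_comp σ.symm m).symm

/-- `γ(σ; τ₁, …, τ_k)` in the symmetric groups operad: the `j`-th input of the `i`-th block goes
to position `τᵢ(j)` of the block at position `σ(i)`; the block at position `i'` of the target has
size `m (σ⁻¹ i')`. -/
def symComp {k : ℕ} (m : Fin k → ℕ) {N : ℕ} (h : N = ∑ i, m i) (σ : SG k)
    (τ : ∀ i, SG (m i)) : SG N :=
  MulOpposite.op
    ((((blk m h).symm.trans (Equiv.sigmaCongrRight fun i => (τ i).unop)).trans
      (Equiv.sigmaCongrLeft' (β := fun i => Fin (m i)) σ.unop)).trans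
      (blk (fun i => m (σ.unop.symm i)) (sum_perm_eq h σ.unop)))

/-- The symmetric groups operad `𝒮`. -/
def symOps : OperadOps SG where
  comp := symComp
  one := 1

/-- `P`, together with `π`, is a group operad: an operad of groups with a morphism of operads `π`
to the symmetric groups operad that consists of homomorphisms, whose unit is the identity of `G₁`
and whose `γ` is a crossed homomorphism. -/
structure IsGroupOperad {G : ℕ → Type v} [∀ n, Group (G n)] (P : OperadOps G)
    (π : ∀ n, G n → SG n) : Prop where
  isOperad : P.IsOperad
  map_mul : ∀ {n : ℕ} (a b : G n), π n (a * b) = π n a * π n b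
  map_unit : π 1 P.one = symOps.one
  map_comp : ∀ {k : ℕ} (m : Fin k → ℕ) {N : ℕ} (h : N = ∑ i, m i) (a : G k) (b : ∀ i, G (m i)),
    π N (P.comp m h a b) = symOps.comp m h (π k a) (fun i => π (m i) (b i))
  unit_eq : P.one = 1
  crossed : ∀ {k : ℕ} (m : Fin k → ℕ) {N : ℕ} (h : N = ∑ i, m i) (a a' : G k)
    (b b' : ∀ i, G (m i)),
    P.comp m h (a * a') (fun i => b i * b' i) =
      P.comp m h a b *
        P.comp (fun i => m ((π k a).unop.symm i)) (sum_perm_eq h _) a'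
          (fun i => b' ((π k a).unop.symm i))

/-- `O` is an operad, and `act` is an action on it of the group operad `(P, π)`. -/
structure IsGOperad {G : ℕ → Type u} [∀ n, Group (G n)] (P : OperadOps G)
    (π : ∀ n, G n → SG n) {X : ℕ → Type v} (O : OperadOps X) (act : ∀ n, G n → X n → X n) :
    Prop where
  isOperad : O.IsOperad
  one_act : ∀ {n : ℕ} (x : X n), act n 1 x = x
  mul_act : ∀ {n : ℕ} (a b : G n) (x : X n), act n (a * b) x = act n a (act n b x)
  equivariant : ∀ {k : ℕ} (m : Fin k → ℕ) {N : ℕ} (h : N = ∑ i, m i) (σ : G k)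
    (τ : ∀ i, G (m i)) (a : X k) (b : ∀ i, X (m i)),
    O.comp m h (act k σ a) (fun i => act (m i) (τ i) (b i)) =
      act N (P.comp m h σ τ)
        (O.comp (fun i => m ((π k σ).unop.symm i)) (sum_perm_eq h _) a
          (fun i => b ((π k σ).unop.symm i)))

/-! ### Topological operads -/

/-- A (nonsymmetric) topological operad. Continuity of `γ` is tested on compact Hausdorff spaces:
for compactly generated Hausdorff `C(n)` this is continuity with respect to the compactly generated
product; it is implied by continuity with respect to the ordinary product topology. -/
structure TopOperad where
  obj : ℕ → Type u
  [top : ∀ n, TopologicalSpace (obj n)]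
  ops : OperadOps obj
  isOperad : ops.IsOperad
  continuous_comp : ∀ {k : ℕ} (m : Fin k → ℕ) {N : ℕ} (h : N = ∑ i, m i)
    (K : Type u) [TopologicalSpace K] [CompactSpace K] [T2Space K]
    (a : K → obj k) (b : ∀ i, K → obj (m i)), Continuous a → (∀ i, Continuous (b i)) →
    Continuous fun x => ops.comp m h (a x) (fun i => b i x)

attribute [instance] TopOperad.top

/-- A symmetric topological operad. -/
structure SymmTopOperad extends TopOperad.{u} where
  [act : ∀ n, MulAction (SG n) (obj n)]
  [continuous_act : ∀ n, ContinuousConstSMul (SG n) (obj n)]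
  isGOperad : IsGOperad symOps (fun _ σ => σ) ops (fun n (σ : SG n) (x : obj n) => σ • x)

attribute [instance] SymmTopOperad.act SymmTopOperad.continuous_act

/-- All the spaces `C(n)` are path-connected. -/
def TopOperad.IsPathConnected (C : TopOperad.{u}) : Prop :=
  ∀ n, PathConnectedSpace (C.obj n)

/-- All the actions of `S_n` on `C(n)` are covering actions: every point has a neighborhood that
is disjoint from all its translates by non-identity elements. -/
def SymmTopOperad.IsCovering (C : SymmTopOperad.{u}) : Prop :=
  ∀ n (x : C.obj n), ∃ U ∈ 𝓝 x, ∀ σ : SG n, (((σ • ·) '' U) ∩ U).Nonempty → σ = 1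

/-! ### The little intervals operad and the component of the standard subdivisions -/

/-- `𝒞₁(k)`: the `k`-tuples of closed subintervals `[(c i).1, (c i).2]` of `[0,1]`, of positive
length, with pairwise disjoint interiors. -/
abbrev LittleIntervals (k : ℕ) : Type :=
  {c : Fin k → ℝ × ℝ // (∀ i, 0 ≤ (c i).1 ∧ (c i).1 < (c i).2 ∧ (c i).2 ≤ 1) ∧
    Pairwise fun i j => Disjoint (Set.Ioo (c i).1 (c i).2) (Set.Ioo (c j).1 (c j).2)}

theorem disjoint_Ioo_iff_of_lt {a b c d : ℝ} (h : a < b) (h' : c < d) :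
    Disjoint (Set.Ioo a b) (Set.Ioo c d) ↔ b ≤ c ∨ d ≤ a := by
  rw [Set.Ioo_disjoint_Ioo, min_le_iff, le_max_iff, le_max_iff]
  constructor
  · rintro ((h1 | h1) | (h1 | h1))
    · linarith
    · exact Or.inl h1
    · exact Or.inr h1
    · linarith
  · rintro (h1 | h1)
    · exact Or.inl (Or.inr h1)
    · exact Or.inr (Or.inl h1)

namespace LittleIntervals

variable {k : ℕ}

/-- The intervals appear in their natural order from left to right. -/
def Ordered (c : LittleIntervals k) : Prop :=
  ∀ i j, i < j → (c.1 i).2 ≤ (c.1 j).1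

/-- Constructor for ordered tuples. -/
def ofOrdered (c : Fin k → ℝ × ℝ) (h : ∀ i, 0 ≤ (c i).1 ∧ (c i).1 < (c i).2 ∧ (c i).2 ≤ 1)
    (h' : ∀ i j, i < j → (c i).2 ≤ (c j).1) : LittleIntervals k :=
  ⟨c, h, fun i j hij => by
    dsimp only
    rw [disjoint_Ioo_iff_of_lt (h i).2.1 (h j).2.1]
    rcases lt_or_gt_of_ne hij with h1 | h1
    · exact Or.inl (h' i j h1)
    · exact Or.inr (h' j i h1)⟩

/-- The standard subdivision `c_k = ([0, 1/k], [1/k, 2/k], …, [(k-1)/k, 1])`. -/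
def std (k : ℕ) : LittleIntervals k :=
  ofOrdered (fun i => ((i : ℝ) / k, ((i : ℝ) + 1) / k))
    (fun i => by
      have hk : (0 : ℝ) < k := by exact_mod_cast i.pos
      refine ⟨by positivity, (div_lt_div_iff_of_pos_right hk).2 (lt_add_one _), ?_⟩
      dsimp only
      rw [div_le_one hk]
      exact_mod_cast i.2)
    (fun i j hij => by
      have hk : (0 : ℝ) < k := by exact_mod_cast i.pos
      have : (i : ℝ) + 1 ≤ j := by exact_mod_cast hij
      simp only
      gcongr)

theorem ordered_std (k : ℕ) : (std k).Ordered := fun i j hij => by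
  have hk : (0 : ℝ) < k := by exact_mod_cast i.pos
  have : (i : ℝ) + 1 ≤ j := by exact_mod_cast hij
  simp only [std, ofOrdered]
  gcongr

/-- The linear path `t ↦ (1 - t) c + t c'` between ordered tuples. -/
def linPath (c c' : LittleIntervals k) (h : c.Ordered) (h' : c'.Ordered) : Path c c' where
  toFun t := ofOrdered
    (fun i => ((1 - (t : ℝ)) * (c.1 i).1 + t * (c'.1 i).1,
      (1 - (t : ℝ)) * (c.1 i).2 + t * (c'.1 i).2))
    (fun i => by
      have h0 := t.2.1
      have h1 : 0 ≤ 1 - (t : ℝ) := sub_nonneg.2 t.2.2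
      obtain ⟨a1, a2, a3⟩ := c.2.1 i
      obtain ⟨b1, b2, b3⟩ := c'.2.1 i
      refine ⟨by positivity, ?_, ?_⟩
      · rcases h0.eq_or_lt with h2 | h2
        · simp only [← h2]; linarith
        · nlinarith [mul_le_mul_of_nonneg_left a2.le h1, mul_lt_mul_of_pos_left b2 h2]
      · nlinarith [mul_le_mul_of_nonneg_left a3 h1, mul_le_mul_of_nonneg_left b3 h0])
    (fun i j hij => by
      have h0 := t.2.1
      have h1 : 0 ≤ 1 - (t : ℝ) := sub_nonneg.2 t.2.2
      have := h i j hij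
      have := h' i j hij
      simp only
      gcongr)
  continuous_toFun := by
    refine Continuous.subtype_mk ?_ _
    fun_prop
  source' := Subtype.ext (by funext i; simp [ofOrdered])
  target' := Subtype.ext (by funext i; simp [ofOrdered])

theorem ordered_linPath (c c' : LittleIntervals k) (h : c.Ordered) (h' : c'.Ordered) (t : unitInterval) :
    (linPath c c' h h' t).Ordered := fun i j hij => by
  have h0 := t.2.1
  have h1 : 0 ≤ 1 - (t : ℝ) := sub_nonneg.2 t.2.2
  have := h i j hij
  have := h' i j hij
  change (1 - (t : ℝ)) * (c.1 i).2 + t * (c'.1 i).2 ≤ (1 - (t : ℝ)) * (c.1 j).1 + t * (c'.1 j).1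
  gcongr

/-- The path component of `c_k` consists of the ordered tuples. -/
theorem joined_std_iff (c : LittleIntervals k) : Joined (std k) c ↔ c.Ordered := by
  refine ⟨fun ⟨p⟩ i j hij => ?_, fun h => ⟨linPath _ _ (ordered_std k) h⟩⟩
  let g : unitInterval → ℝ := fun t => ((p t).1 j).1 - ((p t).1 i).1
  have hg : Continuous g := by
    have h1 : Continuous fun t => (p t).1 := continuous_subtype_val.comp p.continuous
    exact (continuous_fst.comp ((continuous_apply j).comp h1)).sub
      (continuous_fst.comp ((continuous_apply i).comp h1))
  have alt : ∀ d : LittleIntervals k, (d.1 i).2 ≤ (d.1 j).1 ∨ (d.1 j).2 ≤ (d.1 i).1 := fun d =>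
    (disjoint_Ioo_iff_of_lt (d.2.1 i).2.1 (d.2.1 j).2.1).1 (d.2.2 hij.ne)
  have hne : ∀ t, g t ≠ 0 := fun t ht => by
    have h1 := ((p t).2.1 i).2.1
    have h2 := ((p t).2.1 j).2.1
    simp only [g] at ht
    rcases alt (p t) with h | h <;> linarith
  have h0 : 0 < g 0 := by
    simp only [g, p.source]
    have h1 := ((std k).2.1 i).2.1
    linarith [ordered_std k i j hij]
  by_contra hcon
  have h1 : g 1 < 0 := by
    simp only [g, p.target]
    rcases alt c with h | h
    · exact absurd h hcon
    · linarith [(c.2.1 j).2.1]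
  obtain ⟨t, ht⟩ := mem_range_of_exists_le_of_exists_ge hg ⟨1, h1.le⟩ ⟨0, h0.le⟩
  exact hne t ht

/-- Composition in the little intervals operad: the `i`-th tuple `b i` is inserted, by the
increasing affine map `[0,1] → c i`, into the `i`-th interval of `c`. -/
def comp (m : Fin k → ℕ) {N : ℕ} (h : N = ∑ i, m i) (c : LittleIntervals k)
    (b : ∀ i, LittleIntervals (m i)) : LittleIntervals N :=
  ⟨fun p =>
    let q := (blk m h).symm p
    ((c.1 q.1).1 + ((c.1 q.1).2 - (c.1 q.1).1) * ((b q.1).1 q.2).1,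
      (c.1 q.1).1 + ((c.1 q.1).2 - (c.1 q.1).1) * ((b q.1).1 q.2).2), by
    have key : ∀ q : (Σ i, Fin (m i)),
        (c.1 q.1).1 ≤ (c.1 q.1).1 + ((c.1 q.1).2 - (c.1 q.1).1) * ((b q.1).1 q.2).1 ∧
        (c.1 q.1).1 + ((c.1 q.1).2 - (c.1 q.1).1) * ((b q.1).1 q.2).1 <
          (c.1 q.1).1 + ((c.1 q.1).2 - (c.1 q.1).1) * ((b q.1).1 q.2).2 ∧
        (c.1 q.1).1 + ((c.1 q.1).2 - (c.1 q.1).1) * ((b q.1).1 q.2).2 ≤ (c.1 q.1).2 := by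
      intro q
      obtain ⟨a1, a2, a3⟩ := c.2.1 q.1
      obtain ⟨b1, b2, b3⟩ := (b q.1).2.1 q.2
      have hp : 0 < (c.1 q.1).2 - (c.1 q.1).1 := sub_pos.2 a2
      refine ⟨?_, ?_, ?_⟩
      · have := mul_nonneg hp.le b1; linarith
      · have := mul_lt_mul_of_pos_left b2 hp; linarith
      · have := mul_le_mul_of_nonneg_left b3 hp.le; linarith
    refine ⟨fun p => ?_, fun p p' hpp => ?_⟩
    · obtain ⟨h1, h2, h3⟩ := key ((blk m h).symm p)
      obtain ⟨a1, a2, a3⟩ := c.2.1 ((blk m h).symm p).1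
      exact ⟨a1.trans h1, h2, h3.trans a3⟩
    · have hne : (blk m h).symm p ≠ (blk m h).symm p' := fun h => hpp (by simpa using h)
      dsimp only
      generalize (blk m h).symm p = q at *
      generalize (blk m h).symm p' = q' at *
      rw [disjoint_Ioo_iff_of_lt (key q).2.1 (key q').2.1]
      have k1 := key q
      have k2 := key q'
      obtain ⟨i, j⟩ := q
      obtain ⟨i', j'⟩ := q'
      by_cases hi : i = i'
      · subst hi
        have hj : j ≠ j' := fun hj => hne (by rw [hj])
        have hp : 0 ≤ (c.1 i).2 - (c.1 i).1 := (sub_pos.2 (c.2.1 i).2.1).le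
        rcases (disjoint_Ioo_iff_of_lt ((b i).2.1 j).2.1 ((b i).2.1 j').2.1).1 ((b i).2.2 hj)
          with h1 | h1
        · left; have := mul_le_mul_of_nonneg_left h1 hp; simp only; linarith
        · right; have := mul_le_mul_of_nonneg_left h1 hp; simp only; linarith
      · simp only at k1 k2 ⊢
        rcases (disjoint_Ioo_iff_of_lt (c.2.1 i).2.1 (c.2.1 i').2.1).1 (c.2.2 hi) with h1 | h1
        · left; linarith
        · right; linarith⟩

theorem ordered_comp (m : Fin k → ℕ) {N : ℕ} (h : N = ∑ i, m i) {c : LittleIntervals k}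
    {b : ∀ i, LittleIntervals (m i)} (hc : c.Ordered) (hb : ∀ i, (b i).Ordered) :
    (comp m h c b).Ordered := by
  intro p p' hpp
  obtain ⟨⟨i, j⟩, rfl⟩ := (blk m h).surjective p
  obtain ⟨⟨i', j'⟩, rfl⟩ := (blk m h).surjective p'
  have val : ∀ q : (Σ i, Fin (m i)), (comp m h c b).1 (blk m h q) =
      ((c.1 q.1).1 + ((c.1 q.1).2 - (c.1 q.1).1) * ((b q.1).1 q.2).1,
      (c.1 q.1).1 + ((c.1 q.1).2 - (c.1 q.1).1) * ((b q.1).1 q.2).2) := fun q => by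
    conv_rhs => rw [← (blk m h).symm_apply_apply q]
    rfl
  rw [val, val]
  dsimp only
  obtain ⟨a1, a2, a3⟩ := c.2.1 i
  obtain ⟨a1', a2', a3'⟩ := c.2.1 i'
  obtain ⟨b1, b2, b3⟩ := (b i).2.1 j
  obtain ⟨b1', b2', b3'⟩ := (b i').2.1 j'
  rcases lt_trichotomy i i' with hi | hi | hi
  · have h1 := mul_le_mul_of_nonneg_left b3 (sub_pos.2 a2).le
    have h2 := mul_nonneg (sub_pos.2 a2').le b1'
    linarith [hc i i' hi]
  · subst hi
    have := mul_le_mul_of_nonneg_left (hb i j j' ((blk_lt_iff_snd m h i j j').1 hpp))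
      (sub_pos.2 a2).le
    linarith
  · exact absurd hpp (blk_lt m h hi j' j).not_gt

end LittleIntervals

/-- `𝒞₁(k)₀`: the path component of `c_k` in `𝒞₁(k)`. -/
abbrev C10 (k : ℕ) : Type := {c : LittleIntervals k // Joined (LittleIntervals.std k) c}

namespace C10

/-- The standard subdivision `c_k`. -/
def std (k : ℕ) : C10 k := ⟨LittleIntervals.std k, Joined.refl _⟩

/-- The operations of the suboperad `(𝒞₁)₀` of the little intervals operad; the unit is the
interval `[0,1]`. -/
def ops : OperadOps C10 where
  comp m _ h c b := ⟨LittleIntervals.comp m h c.1 (fun i => (b i).1),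
    (LittleIntervals.joined_std_iff _).2 (LittleIntervals.ordered_comp m h
      ((LittleIntervals.joined_std_iff _).1 c.2)
      (fun i => (LittleIntervals.joined_std_iff _).1 (b i).2))⟩
  one := std 1

/-- The linear path `t ↦ (1 - t) c + t c'` in `𝒞₁(k)₀`. -/
def linPath {k : ℕ} (c c' : C10 k) : Path c c' where
  toFun t := ⟨LittleIntervals.linPath c.1 c'.1 ((LittleIntervals.joined_std_iff _).1 c.2)
      ((LittleIntervals.joined_std_iff _).1 c'.2) t,
    (LittleIntervals.joined_std_iff _).2 (LittleIntervals.ordered_linPath _ _ _ _ t)⟩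
  continuous_toFun := Continuous.subtype_mk (Path.continuous _) _
  source' := Subtype.ext (Path.source _)
  target' := Subtype.ext (Path.target _)

end C10

/-- A morphism of nonsymmetric topological operads `η : (𝒞₁)₀ → C`; the sequence `η(c_k)` is the
corresponding good basepoint. -/
structure GoodBasepoint (C : TopOperad.{u}) where
  η : ∀ k, C10 k → C.obj k
  continuous_η : ∀ k, Continuous (η k)
  map_one : η 1 C10.ops.one = C.ops.one
  map_comp : ∀ {k : ℕ} (m : Fin k → ℕ) {N : ℕ} (h : N = ∑ i, m i) (c : C10 k)
    (b : ∀ i, C10 (m i)),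
    η N (C10.ops.comp m h c b) = C.ops.comp m h (η k c) (fun i => η (m i) (b i))

namespace GoodBasepoint

variable {C : TopOperad.{u}} (E : GoodBasepoint C)

/-- The points `e_k = η(c_k)`. -/
def e (k : ℕ) : C.obj k := E.η k (C10.std k)

/-- The linear path `δ` from `e_N` to `γ(e_k; e_{m₁}, …, e_{m_k})`. -/
def δ {k : ℕ} (m : Fin k → ℕ) {N : ℕ} (h : N = ∑ i, m i) :
    Path (E.e N) (C.ops.comp m h (E.e k) (fun i => E.e (m i))) :=
  ((C10.linPath (C10.std N) (C10.ops.comp m h (C10.std k) (fun i => C10.std (m i)))).map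
    (E.continuous_η N)).cast rfl (E.map_comp m h _ _).symm

end GoodBasepoint

/-! ### Fundamental groups and their action on higher homotopy groups -/

/-- The fundamental group, with product `[f][g] = [f · g]` (first `f`, then `g`). -/
def Pi1 (X : Type u) [TopologicalSpace X] (x : X) : Type u := Path.Homotopic.Quotient x x

instance (X : Type u) [TopologicalSpace X] (x : X) : Group (Pi1 X x) where
  mul a b := Path.Homotopic.Quotient.trans a b
  one := Path.Homotopic.Quotient.refl x
  inv a := Path.Homotopic.Quotient.symm a
  mul_assoc a b c := by
    induction a using Quotient.inductionOn with | _ a => ?_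
    induction b using Quotient.inductionOn with | _ b => ?_
    induction c using Quotient.inductionOn with | _ c => ?_
    exact Quotient.sound ⟨Path.Homotopy.transAssoc a b c⟩
  one_mul a := by
    induction a using Quotient.inductionOn with | _ a => ?_
    exact Quotient.sound ⟨Path.Homotopy.reflTrans a⟩
  mul_one a := by
    induction a using Quotient.inductionOn with | _ a => ?_
    exact Quotient.sound ⟨Path.Homotopy.transRefl a⟩
  inv_mul_cancel a := by
    induction a using Quotient.inductionOn with | _ a => ?_
    exact Quotient.sound ⟨(Path.Homotopy.reflSymmTrans a).symm⟩

section Shell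

variable {l : ℕ}

/-- Distance from the center of the cube, rescaled to take the value `1` on the boundary. -/
def cubeRad (t : Fin l → unitInterval) : ℝ := ‖fun i => 2 * (t i : ℝ) - 1‖

/-- The map stretching the inner cube `[1/4, 3/4]^l` onto the cube. -/
def cubeInner (t : Fin l → unitInterval) : Fin l → unitInterval := fun i =>
  Set.projIcc (0 : ℝ) 1 zero_le_one (2 * (t i : ℝ) - 1 / 2)

/-- The collapse of the shell around the inner cube to the interval: the boundary of the cube goes
to `0` and the boundary of the inner cube goes to `1`. -/
def cubeOuter (t : Fin l → unitInterval) : unitInterval := Set.projIcc (0 : ℝ) 1 zero_le_one (2 - 2 * cubeRad t)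

theorem continuous_cubeRad : Continuous (cubeRad (l := l)) := by
  unfold cubeRad; fun_prop

theorem continuous_cubeInner : Continuous (cubeInner (l := l)) := by
  refine continuous_pi fun i => ?_
  exact continuous_projIcc.comp (by fun_prop)

theorem continuous_cubeOuter : Continuous (cubeOuter (l := l)) :=
  continuous_projIcc.comp (continuous_const.sub (continuous_const.mul continuous_cubeRad))

theorem cubeOuter_of_rad_eq {t : Fin l → unitInterval} (h : cubeRad t = 1 / 2) : cubeOuter t = 1 := by
  unfold cubeOuter
  rw [h]
  exact Set.projIcc_of_right_le _ (by norm_num)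

theorem cubeInner_of_rad_eq {t : Fin l → unitInterval} (h : cubeRad t = 1 / 2) :
    cubeInner t ∈ Cube.boundary (Fin l) := by
  by_contra hcon
  have hlt : cubeRad t < 1 / 2 := by
    refine (pi_norm_lt_iff (by norm_num)).2 fun i => ?_
    rw [Real.norm_eq_abs, abs_lt]
    have h0 : cubeInner t i ≠ 0 := fun h0 => hcon ⟨i, Or.inl h0⟩
    have h1 : cubeInner t i ≠ 1 := fun h1 => hcon ⟨i, Or.inr h1⟩
    constructor
    · by_contra hle
      exact h0 (Set.projIcc_of_le_left _ (by linarith))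
    · by_contra hle
      exact h1 (Set.projIcc_of_right_le _ (by linarith))
  exact absurd h hlt.ne

theorem cubeRad_of_mem_boundary {t : Fin l → unitInterval} (h : t ∈ Cube.boundary (Fin l)) :
    1 ≤ cubeRad t := by
  obtain ⟨i, hi⟩ := h
  have h1 := norm_le_pi_norm (fun i => 2 * (t i : ℝ) - 1) i
  refine le_trans ?_ h1
  rcases hi with hi | hi <;> simp only [hi] <;> norm_num

theorem cubeOuter_of_mem_boundary {t : Fin l → unitInterval} (h : t ∈ Cube.boundary (Fin l)) :
    cubeOuter t = 0 :=
  Set.projIcc_of_le_left _ (by linarith [cubeRad_of_mem_boundary h])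

variable {X : Type u} [TopologicalSpace X]

theorem continuous_shell {K : Type v} [TopologicalSpace K] (P : K → unitInterval → X)
    (F : K → (Fin l → unitInterval) → X)
    (hP : Continuous (Function.uncurry P)) (hF : Continuous (Function.uncurry F))
    (h : ∀ s, ∀ t ∈ Cube.boundary (Fin l), F s t = P s 1) :
    Continuous fun x : K × (Fin l → unitInterval) =>
      if cubeRad x.2 ≤ 1 / 2 then F x.1 (cubeInner x.2) else P x.1 (cubeOuter x.2) := by
  refine Continuous.if_le ?_ ?_ (continuous_cubeRad.comp continuous_snd) continuous_const ?_
  · exact hF.comp (continuous_fst.prodMk (continuous_cubeInner.comp continuous_snd))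
  · exact hP.comp (continuous_fst.prodMk (continuous_cubeOuter.comp continuous_snd))
  · intro x hx
    rw [cubeOuter_of_rad_eq hx]
    exact h _ _ (cubeInner_of_rad_eq hx)

/-- The map `S^l → S^l ∨ S^l → I ∨ S^l → X` given by a path `p` from `x` to `y` and a map `f`
based at `y`, in terms of cubes: `f` on the inner cube, and `p` (from the outside to the inside) on
the shell around it. -/
def shell {x y : X} (p : Path x y) (f : GenLoop (Fin l) X y) : GenLoop (Fin l) X x :=
  ⟨⟨fun t => if cubeRad t ≤ 1 / 2 then f (cubeInner t) else p (cubeOuter t), by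
      have := continuous_shell (K := Unit) (fun _ => p) (fun _ => f)
        (p.continuous.comp continuous_snd) (f.1.continuous.comp continuous_snd)
        (fun _ t ht => (f.2 t ht).trans p.target.symm)
      exact this.comp (g := _) (f := fun t => ((), t)) (continuous_const.prodMk continuous_id)⟩, fun t ht => by
    have h1 := cubeRad_of_mem_boundary ht
    change (if cubeRad t ≤ 1 / 2 then f (cubeInner t) else p (cubeOuter t)) = x
    rw [if_neg (by linarith), cubeOuter_of_mem_boundary ht, p.source]⟩

theorem shell_homotopic {x y : X} {p p' : Path x y} (hp : p.Homotopic p')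
    {f f' : GenLoop (Fin l) X y} (hf : GenLoop.Homotopic f f') :
    GenLoop.Homotopic (shell p f) (shell p' f') := by
  obtain ⟨P⟩ := hp
  obtain ⟨F⟩ := hf
  refine ⟨⟨⟨⟨fun x => if cubeRad x.2 ≤ 1 / 2 then F (x.1, cubeInner x.2)
    else P (x.1, cubeOuter x.2), ?_⟩, ?_, ?_⟩, ?_⟩⟩
  · refine continuous_shell (fun s u => P (s, u)) (fun s t => F (s, t)) P.continuous F.continuous ?_
    intro s t ht
    rw [F.eq_fst s ht, P.target]
    exact f.2 t ht
  · intro t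
    change (if _ then _ else _) = if _ then _ else _
    simp only [F.apply_zero, P.apply_zero]
    rfl
  · intro t
    change (if _ then _ else _) = if _ then _ else _
    simp only [F.apply_one, P.apply_one]
    rfl
  · intro s t ht
    have h1 := cubeRad_of_mem_boundary ht
    change (if _ then _ else _) = (shell p f) t
    rw [show (shell p f) t = x from (shell p f).2 t ht]
    dsimp only
    rw [if_neg (by linarith), cubeOuter_of_mem_boundary ht, P.source]

/-- The change of basepoint `π_l(X, y) → π_l(X, x)` along a homotopy class of paths from `x` to
`y`. -/
def transportPi {x y : X} (p : Path.Homotopic.Quotient x y) (f : π_ l X y) : π_ l X x :=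
  Quotient.map₂ shell (fun _ _ hp _ _ hf => shell_homotopic hp hf) p f

/-- The usual action `[a] ⋆ [f]` of `π₁(X, x)` on `π_l(X, x)`. -/
def piAct {x : X} (a : Pi1 X x) (f : π_ l X x) : π_ l X x := transportPi a f

/-- The map induced on `π_l`. -/
def piMap {Y : Type v} [TopologicalSpace Y] (q : C(X, Y)) (x : X) (f : π_ l X x) : π_ l Y (q x) :=
  Quotient.map (fun f : GenLoop (Fin l) X x =>
      (⟨q.comp f.1, fun t ht => congrArg q (f.2 t ht)⟩ : GenLoop (Fin l) Y (q x)))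
    (fun _ _ h => ContinuousMap.HomotopicRel.comp_continuousMap h q) f

end Shell

/-! ### `γ` on paths and on spheres -/

namespace TopOperad

variable (C : TopOperad.{u}) {k : ℕ} (m : Fin k → ℕ) {N : ℕ} (h : N = ∑ i, m i)

theorem continuous_comp_of_compact {K : Type} [TopologicalSpace K] [CompactSpace K] [T2Space K]
    {a : K → C.obj k} {b : ∀ i, K → C.obj (m i)} (ha : Continuous a)
    (hb : ∀ i, Continuous (b i)) : Continuous fun x => C.ops.comp m h (a x) (fun i => b i x) :=
  (C.continuous_comp m h (ULift.{u} K) (fun x => a x.down) (fun i x => b i x.down)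
    (ha.comp continuous_uliftDown) (fun i => (hb i).comp continuous_uliftDown)).comp
    continuous_uliftUp

variable {a a' : C.obj k} {b b' : ∀ i, C.obj (m i)}

/-- The path `γ(f; g₁, …, g_k)`. -/
def pathComp (f : Path a a') (g : ∀ i, Path (b i) (b' i)) :
    Path (C.ops.comp m h a b) (C.ops.comp m h a' b') where
  toFun t := C.ops.comp m h (f t) (fun i => g i t)
  continuous_toFun := C.continuous_comp_of_compact m h f.continuous (fun i => (g i).continuous)
  source' := by simp
  target' := by simp

theorem pathComp_homotopic {f f' : Path a a'} {g g' : ∀ i, Path (b i) (b' i)}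
    (hf : f.Homotopic f') (hg : ∀ i, (g i).Homotopic (g' i)) :
    (C.pathComp m h f g).Homotopic (C.pathComp m h f' g') := by
  obtain ⟨F⟩ := hf
  have G := fun i => (hg i).some
  refine ⟨⟨⟨⟨fun x => C.ops.comp m h (F x) (fun i => G i x),
    C.continuous_comp_of_compact m h F.continuous (fun i => (G i).continuous)⟩, ?_, ?_⟩, ?_⟩⟩
  · intro t; simp [pathComp]
  · intro t; simp [pathComp]
  · rintro s t (rfl | rfl) <;> simp [pathComp]

/-- `γ` on homotopy classes of paths: `γ([f]; [g₁], …, [g_k]) = [γ(f; g₁, …, g_k)]`. -/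
def pathCompQ (f : Path.Homotopic.Quotient a a')
    (g : ∀ i, Path.Homotopic.Quotient (b i) (b' i)) :
    Path.Homotopic.Quotient (C.ops.comp m h a b) (C.ops.comp m h a' b') :=
  .mk (C.pathComp m h (Quotient.out f) (fun i => Quotient.out (g i)))

theorem pathCompQ_mk (f : Path a a') (g : ∀ i, Path (b i) (b' i)) :
    C.pathCompQ m h (.mk f) (fun i => .mk (g i)) = .mk (C.pathComp m h f g) :=
  Path.Homotopic.Quotient.eq.2
    (C.pathComp_homotopic m h (Quotient.mk_out (s := Path.Homotopic.setoid _ _) f)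
      (fun i => Quotient.mk_out (s := Path.Homotopic.setoid _ _) (g i)))

variable {l : ℕ}

/-- The map `γ(f; g₁, …, g_k)`, `t ↦ γ(f(t); g₁(t), …, g_k(t))`. -/
def loopComp (f : GenLoop (Fin l) (C.obj k) a) (g : ∀ i, GenLoop (Fin l) (C.obj (m i)) (b i)) :
    GenLoop (Fin l) (C.obj N) (C.ops.comp m h a b) :=
  ⟨⟨fun t => C.ops.comp m h (f t) (fun i => g i t),
    C.continuous_comp_of_compact m h f.1.continuous (fun i => (g i).1.continuous)⟩,
    fun t ht => by
      change C.ops.comp m h (f t) (fun i => g i t) = _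
      rw [show f t = a from f.2 t ht, show (fun i => g i t) = b from
        funext fun i => (g i).2 t ht]⟩

theorem loopComp_homotopic {f f' : GenLoop (Fin l) (C.obj k) a}
    {g g' : ∀ i, GenLoop (Fin l) (C.obj (m i)) (b i)} (hf : GenLoop.Homotopic f f')
    (hg : ∀ i, GenLoop.Homotopic (g i) (g' i)) :
    GenLoop.Homotopic (C.loopComp m h f g) (C.loopComp m h f' g') := by
  obtain ⟨F⟩ := hf
  have G := fun i => (hg i).some
  refine ⟨⟨⟨⟨fun x => C.ops.comp m h (F x) (fun i => G i x),
    C.continuous_comp_of_compact m h F.continuous (fun i => (G i).continuous)⟩, ?_, ?_⟩, ?_⟩⟩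
  · intro t
    simp only [ContinuousMap.HomotopyWith.apply_zero]
    rfl
  · intro t
    simp only [ContinuousMap.HomotopyWith.apply_one]
    rfl
  · intro s t ht
    change C.ops.comp m h (F (s, t)) (fun i => G i (s, t)) =
      C.ops.comp m h (f t) (fun i => g i t)
    rw [F.eq_fst s ht, show (fun i => G i (s, t)) = fun i => g i t from
      funext fun i => (G i).eq_fst s ht]
    rfl

/-- The map `γ_*` on `π_l`: `γ_*([f]; [g₁], …, [g_k]) = [γ(f; g₁, …, g_k)]`. -/
def loopCompQ (f : π_ l (C.obj k) a) (g : ∀ i, π_ l (C.obj (m i)) (b i)) :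
    π_ l (C.obj N) (C.ops.comp m h a b) :=
  Quotient.mk _ (C.loopComp m h (Quotient.out f) (fun i => Quotient.out (g i)))

theorem loopCompQ_mk (f : GenLoop (Fin l) (C.obj k) a)
    (g : ∀ i, GenLoop (Fin l) (C.obj (m i)) (b i)) :
    C.loopCompQ (l := l) m h (Quotient.mk _ f) (fun i => Quotient.mk _ (g i)) =
      Quotient.mk _ (C.loopComp m h f g) :=
  Quotient.sound (C.loopComp_homotopic m h (Quotient.mk_out f) (fun i => Quotient.mk_out (g i)))

end TopOperad

/-! ### The homotopy groups operads -/

namespace GoodBasepoint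

variable {C : TopOperad.{u}} (E : GoodBasepoint C)

/-- `π₁C = {π₁(C(k), e_k)}`. -/
abbrev pi1 (k : ℕ) : Type u := Pi1 (C.obj k) (E.e k)

/-- `π_l C = {π_l(C(k), e_k)}`. -/
abbrev pil (l k : ℕ) : Type u := π_ l (C.obj k) (E.e k)

/-- The operad operations of `π₁C`: `γ([f]; [g₁], …) = [δ] [γ(f; g₁, …)] [δ]⁻¹`. -/
def pi1Ops : OperadOps E.pi1 where
  comp m _ h f g := ((Path.Homotopic.Quotient.mk (E.δ m h)).trans (C.pathCompQ m h f g)).trans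
    (Path.Homotopic.Quotient.mk (E.δ m h)).symm
  one := 1

/-- The operad operations of `π_l C`: `γ = δ_* ∘ γ_*`; the unit is the class of the constant map
at `e₁ = 1`. -/
def pilOps (l : ℕ) : OperadOps (E.pil l) where
  comp m _ h f g := transportPi (.mk (E.δ m h)) (C.loopCompQ m h f g)
  one := Quotient.mk _ GenLoop.const

end GoodBasepoint

/-! ### The symmetric case -/

namespace SymmTopOperad

variable (C : SymmTopOperad.{u})

/-- The orbit space `C(k)/S_k`. -/
abbrev orbitSpace (k : ℕ) : Type u := MulAction.orbitRel.Quotient (SG k) (C.obj k)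

/-- The quotient map `C(k) → C(k)/S_k`. -/
def quot (k : ℕ) : C(C.obj k, C.orbitSpace k) :=
  ⟨Quotient.mk (MulAction.orbitRel (SG k) (C.obj k)), continuous_quot_mk⟩

theorem quot_smul {k : ℕ} (σ : SG k) (x : C.obj k) : C.quot k (σ • x) = C.quot k x :=
  Quotient.sound ⟨σ, rfl⟩

variable (E : GoodBasepoint C.toTopOperad)

/-- `π₁(C/𝒮) = {π₁(C(k)/S_k, S_k e_k)}`. -/
abbrev pi1 (k : ℕ) : Type u := Pi1 (C.orbitSpace k) (C.quot k (E.e k))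

/-- `π_l(C/𝒮) = {π_l(C(k)/S_k, S_k e_k)}`. -/
abbrev pil (l k : ℕ) : Type u := π_ l (C.orbitSpace k) (C.quot k (E.e k))

/-- `π₁(C(k); e_k, S_k e_k)`: homotopy classes relative to the endpoints of paths in `C(k)` from
`e_k` to a point `σ e_k` of its orbit, recorded together with `σ`. -/
abbrev liftedPi1 (k : ℕ) : Type u := Σ σ : SG k, Path.Homotopic.Quotient (E.e k) (σ • E.e k)

/-- The natural map `π₁(C(k); e_k, S_k e_k) → π₁(C(k)/S_k, S_k e_k)`. -/
def projPi1 (k : ℕ) (x : C.liftedPi1 E k) : C.pi1 E k :=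
  (x.2.map (C.quot k)).cast rfl (C.quot_smul x.1 (E.e k)).symm

/-- The operad operations of `{π₁(C(k); e_k, S_k e_k)}`: `γ([f]; [g₁], …)` is the class of the path
`δ₁ · γ(f; g₁, …) · γ(σ; τ₁, …)δ₂⁻¹` from `e_N` to `γ(σ; τ₁, …) e_N`, where `f` ends at `σ e_k`,
`gᵢ` ends at `τᵢ e_{mᵢ}`, and `δ₂` is the linear path from `e_N` to
`γ(e_k; e_{m_{σ⁻¹(1)}}, …, e_{m_{σ⁻¹(k)}})`. -/
def liftedPi1Ops : OperadOps (C.liftedPi1 E) where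
  comp {k} m {N} h x y :=
    ⟨symOps.comp m h x.1 (fun i => (y i).1),
      ((Path.Homotopic.Quotient.mk (E.δ m h)).trans
        (C.pathCompQ m h x.2 (fun i => (y i).2))).trans
        (((Path.Homotopic.Quotient.mk
            (E.δ (fun i => m (x.1.unop.symm i)) (sum_perm_eq h x.1.unop))).symm.map
          ⟨fun z : C.obj N => symOps.comp m h x.1 (fun i => (y i).1) • z,
            continuous_const_smul _⟩).cast
          (C.isGOperad.equivariant m h x.1 (fun i => (y i).1) (E.e k) (fun i => E.e (m i)))
          rfl)⟩
  one := ⟨1, (Path.Homotopic.Quotient.refl (E.e 1)).cast rfl (one_smul _ _)⟩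

end SymmTopOperad

end

/-!
The space `(𝒞₁)₀(k)` is convex, so all paths between two of its points are homotopic. Hence the
images under `η` of linear paths give a canonical class of paths between any two points of the image
of `η`, and these classes are compatible with composition of paths and with `γ`. For a group operad
`G` acting on `C`, a path class from `e_k` to `σ e_k` is therefore determined by any class of paths
from some `η c` to some `σ η c'`, from which it is recovered by adding canonical classes at both
ends, and such representatives may be multiplied and composed pointwise. So the operad axioms, the
crossed product rule and the equivariance of the action follow from the corresponding pointwise
identities in `C`.

The fundamental groups of `C` are the path classes for the trivial groups. For `G = 𝒮` acting by
covering actions, lifting of paths and spheres identifies the path classes with the fundamental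
groups of the orbit spaces, and the higher homotopy groups of `C` with those of the orbit spaces.
-/

universe w

/-! ### Homotopy classes of paths with propositionally equal endpoints -/

section SamePath

variable {X : Type u} {Y : Type v} [TopologicalSpace X] [TopologicalSpace Y]

theorem quotient_map_trans {x y z : X} (p : Path.Homotopic.Quotient x y)
    (q : Path.Homotopic.Quotient y z) (f : C(X, Y)) :
    (p.trans q).map f = (p.map f).trans (q.map f) := by
  obtain ⟨p, rfl⟩ := Path.Homotopic.Quotient.mk_surjective p
  obtain ⟨q, rfl⟩ := Path.Homotopic.Quotient.mk_surjective q
  exact congrArg Path.Homotopic.Quotient.mk (p.map_trans q f.continuous)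

theorem exists_pathFamily_mk {ι : Type*} {Z : ι → Type*} [∀ i, TopologicalSpace (Z i)]
    {b b' : ∀ i, Z i} (g : ∀ i, Path.Homotopic.Quotient (b i) (b' i)) :
    ∃ g' : ∀ i, Path (b i) (b' i), g = fun i => .mk (g' i) := by
  choose g' hg' using fun i => Path.Homotopic.Quotient.mk_surjective (g i)
  exact ⟨g', funext fun i => (hg' i).symm⟩

/-- Equality of homotopy classes of paths whose endpoints agree only propositionally. In an operad
the endpoints of two composites agree only up to the operad axioms, and this relation avoids
casting along them. -/
inductive SamePath : ∀ {x y x' y' : X},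
    Path.Homotopic.Quotient x y → Path.Homotopic.Quotient x' y' → Prop
  | refl {x y : X} (p : Path.Homotopic.Quotient x y) : SamePath p p

namespace SamePath

variable {x y z x' y' z' x'' y'' : X}

theorem eq {p q : Path.Homotopic.Quotient x y} (h : SamePath p q) : p = q := by
  cases h; rfl

theorem of_eq {p q : Path.Homotopic.Quotient x y} (h : p = q) : SamePath p q := h ▸ .refl _

theorem symm {p : Path.Homotopic.Quotient x y} {q : Path.Homotopic.Quotient x' y'}
    (h : SamePath p q) : SamePath q p := by
  cases h; exact .refl _

theorem trans {p : Path.Homotopic.Quotient x y} {q : Path.Homotopic.Quotient x' y'}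
    {r : Path.Homotopic.Quotient x'' y''} (h : SamePath p q) (h' : SamePath q r) :
    SamePath p r := by
  cases h; exact h'

theorem cast (p : Path.Homotopic.Quotient x y) (hx : x' = x) (hy : y' = y) :
    SamePath (p.cast hx hy) p := by
  subst hx hy
  exact of_eq p.cast_rfl_rfl

theorem iff_exists_eq_cast {p : Path.Homotopic.Quotient x y}
    {q : Path.Homotopic.Quotient x' y'} :
    SamePath p q ↔ ∃ (hx : x = x') (hy : y = y'), p = q.cast hx hy := by
  refine ⟨fun h => ?_, fun ⟨hx, hy, h⟩ => h ▸ cast q hx hy⟩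
  cases h
  exact ⟨rfl, rfl, p.cast_rfl_rfl.symm⟩

theorem concat {p : Path.Homotopic.Quotient x y} {q : Path.Homotopic.Quotient y z}
    {p' : Path.Homotopic.Quotient x' y'} {q' : Path.Homotopic.Quotient y' z'}
    (h : SamePath p p') (h' : SamePath q q') : SamePath (p.trans q) (p'.trans q') := by
  obtain ⟨rfl, rfl, rfl⟩ := iff_exists_eq_cast.1 h
  obtain ⟨_, rfl, rfl⟩ := iff_exists_eq_cast.1 h'
  simp only [Path.Homotopic.Quotient.cast_rfl_rfl]
  exact .refl _

theorem reverse {p : Path.Homotopic.Quotient x y} {p' : Path.Homotopic.Quotient x' y'}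
    (h : SamePath p p') : SamePath p.symm p'.symm := by
  cases h; exact .refl _

theorem map {p : Path.Homotopic.Quotient x y} {p' : Path.Homotopic.Quotient x' y'}
    (h : SamePath p p') (f : C(X, Y)) : SamePath (p.map f) (p'.map f) := by
  cases h; exact .refl _

theorem mk {p : Path x y} {q : Path x' y'} (h : ∀ t, p t = q t) :
    SamePath (Path.Homotopic.Quotient.mk p) (Path.Homotopic.Quotient.mk q) := by
  obtain rfl : x = x' := by simpa using h 0
  obtain rfl : y = y' := by simpa using h 1
  exact of_eq (congrArg _ (Path.ext (funext h)))

theorem map_of_forall_eq (p : Path.Homotopic.Quotient x y) {f : C(X, X)} (hf : ∀ z, f z = z) :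
    SamePath (p.map f) p := by
  obtain ⟨p, rfl⟩ := Path.Homotopic.Quotient.mk_surjective p
  exact mk fun t => hf (p t)

end SamePath

end SamePath

/-! ### The change of basepoint on homotopy groups -/

section FreeHomotopy

variable {X : Type u} {Y : Type v} [TopologicalSpace X] [TopologicalSpace Y]
  {l : ℕ} {x y z : X}

/-- `f` and `g` are homotopic through maps that send the boundary of the cube to the points of the
path `p`: this characterizes the classes that correspond under the change of basepoint along `p`. -/
def FreelyHomotopic (p : Path x y) (f : GenLoop (Fin l) X x) (g : GenLoop (Fin l) X y) : Prop :=
  ∃ H : ContinuousMap.Homotopy f.1 g.1, ∀ s, ∀ t ∈ Cube.boundary (Fin l), H (s, t) = p s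

theorem FreelyHomotopic.trans {p : Path x y} {q : Path y z} {f : GenLoop (Fin l) X x}
    {g : GenLoop (Fin l) X y} {k : GenLoop (Fin l) X z} (h : FreelyHomotopic p f g)
    (h' : FreelyHomotopic q g k) : FreelyHomotopic (p.trans q) f k := by
  obtain ⟨H, hH⟩ := h
  obtain ⟨H', hH'⟩ := h'
  refine ⟨H.trans H', fun s t ht => ?_⟩
  simp only [ContinuousMap.Homotopy.trans_apply, Path.trans_apply]
  split_ifs
  · exact hH _ t ht
  · exact hH' _ t ht

theorem FreelyHomotopic.homotopic {f g : GenLoop (Fin l) X x}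
    (h : FreelyHomotopic (Path.refl x) f g) : GenLoop.Homotopic f g := by
  obtain ⟨H, hH⟩ := h
  exact ⟨⟨H, fun s t ht => (hH s t ht).trans (f.2 t ht).symm⟩⟩

theorem cubeRad_le_one (t : Fin l → unitInterval) : cubeRad t ≤ 1 := by
  refine (pi_norm_le_iff_of_nonneg zero_le_one).2 fun i => ?_
  rw [Real.norm_eq_abs, abs_le]
  constructor <;> linarith [(t i).2.1, (t i).2.2]

theorem cubeRad_eq_one_of_mem_boundary {t : Fin l → unitInterval}
    (ht : t ∈ Cube.boundary (Fin l)) : cubeRad t = 1 :=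
  le_antisymm (cubeRad_le_one t) (cubeRad_of_mem_boundary ht)

theorem shell_of_mem_boundary (p : Path x y) (g : GenLoop (Fin l) X y)
    {t : Fin l → unitInterval} (ht : t ∈ Cube.boundary (Fin l)) : shell p g t = x :=
  (shell p g).2 t ht

/-- The map stretching the concentric cube of radius `1 / r` onto the cube. -/
noncomputable def cubeStretch (r : ℝ) (t : Fin l → unitInterval) : Fin l → unitInterval := fun i =>
  Set.projIcc (0 : ℝ) 1 zero_le_one (r * ((t i : ℝ) - 1 / 2) + 1 / 2)

theorem cubeStretch_mem_boundary {r : ℝ} {t : Fin l → unitInterval} (h : r * cubeRad t = 1) :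
    cubeStretch r t ∈ Cube.boundary (Fin l) := by
  have hr : 0 < r := pos_of_mul_pos_left (h ▸ one_pos) (norm_nonneg _)
  by_contra hcon
  have hlt : cubeRad t < 1 / r := by
    refine (pi_norm_lt_iff (by positivity)).2 fun i => ?_
    rw [Real.norm_eq_abs, abs_lt, ← neg_div, div_lt_iff₀ hr, lt_div_iff₀ hr]
    have h0 : cubeStretch r t i ≠ 0 := fun h0 => hcon ⟨i, Or.inl h0⟩
    have h1 : cubeStretch r t i ≠ 1 := fun h1 => hcon ⟨i, Or.inr h1⟩
    constructor
    · by_contra! hle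
      exact h0 (Set.projIcc_of_le_left _ (by linarith))
    · by_contra! hle
      exact h1 (Set.projIcc_of_right_le _ (by linarith))
  rw [lt_div_iff₀ hr] at hlt
  linarith

theorem cubeStretch_one (t : Fin l → unitInterval) : cubeStretch 1 t = t := by
  funext i
  simp only [cubeStretch, one_mul, sub_add_cancel, Set.projIcc_val]

theorem cubeStretch_two (t : Fin l → unitInterval) : cubeStretch 2 t = cubeInner t := by
  funext i
  simp only [cubeStretch, cubeInner]
  congr 1
  ring

/-- `g` on the concentric cube of radius `1 / r` and `p` on the shell around it. At `r = 2` this is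
`shell p g`; as `r` decreases to `1` the shell is squeezed out and only `g` remains. -/
noncomputable def shellOfRadius (p : Path x y) (g : GenLoop (Fin l) X y) (r : ℝ)
    (t : Fin l → unitInterval) : X :=
  if r * cubeRad t ≤ 1 then g (cubeStretch r t)
  else p (Set.projIcc (0 : ℝ) 1 zero_le_one (2 - r * cubeRad t))

theorem continuous_shellOfRadius (p : Path x y) (g : GenLoop (Fin l) X y) :
    Continuous (Function.uncurry (shellOfRadius p g)) := by
  have hrad : Continuous fun a : ℝ × (Fin l → unitInterval) => a.1 * cubeRad a.2 :=
    continuous_fst.mul (continuous_cubeRad.comp continuous_snd)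
  have hstretch : Continuous fun a : ℝ × (Fin l → unitInterval) => cubeStretch a.1 a.2 :=
    continuous_pi fun i => continuous_projIcc.comp (by fun_prop)
  refine Continuous.if_le (g.1.continuous.comp hstretch)
    (p.continuous.comp (continuous_projIcc.comp (continuous_const.sub hrad)))
    hrad continuous_const fun a ha => ?_
  rw [ha, Set.projIcc_of_right_le _ (by norm_num)]
  exact (g.2 _ (cubeStretch_mem_boundary ha)).trans p.target.symm

theorem shellOfRadius_two (p : Path x y) (g : GenLoop (Fin l) X y) (t : Fin l → unitInterval) :
    shellOfRadius p g 2 t = shell p g t := by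
  simp only [shellOfRadius, cubeStretch_two]
  exact if_congr (by constructor <;> intro h <;> linarith) rfl rfl

theorem shellOfRadius_one (p : Path x y) (g : GenLoop (Fin l) X y) (t : Fin l → unitInterval) :
    shellOfRadius p g 1 t = g t := by
  rw [shellOfRadius, one_mul, if_pos (cubeRad_le_one t), cubeStretch_one]

theorem shellOfRadius_of_mem_boundary (p : Path x y) (g : GenLoop (Fin l) X y) (s : unitInterval)
    {t : Fin l → unitInterval} (ht : t ∈ Cube.boundary (Fin l)) :
    shellOfRadius p g (2 - s) t = p s := by
  rcases eq_or_ne s 1 with rfl | hs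
  · rw [Set.Icc.coe_one, show (2 : ℝ) - 1 = 1 by norm_num, shellOfRadius_one, p.target]
    exact g.2 t ht
  · have hs' : (s : ℝ) < 1 := unitInterval.lt_one_iff_ne_one.2 hs
    rw [shellOfRadius, cubeRad_eq_one_of_mem_boundary ht, mul_one, if_neg (by linarith),
      sub_sub_cancel, Set.projIcc_val]

theorem freelyHomotopic_shell (p : Path x y) (g : GenLoop (Fin l) X y) :
    FreelyHomotopic p (shell p g) g := by
  have hcont : Continuous fun a : unitInterval × (Fin l → unitInterval) =>
      shellOfRadius p g (2 - (a.1 : ℝ)) a.2 :=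
    (continuous_shellOfRadius p g).comp
      (f := fun a : unitInterval × (Fin l → unitInterval) => ((2 : ℝ) - a.1, a.2)) (by fun_prop)
  refine ⟨⟨⟨_, hcont⟩, fun t => ?_, fun t => ?_⟩,
    fun s t ht => shellOfRadius_of_mem_boundary p g s ht⟩
  · change shellOfRadius p g (2 - ((0 : unitInterval) : ℝ)) t = shell p g t
    rw [Set.Icc.coe_zero, sub_zero, shellOfRadius_two]
  · change shellOfRadius p g (2 - ((1 : unitInterval) : ℝ)) t = g t
    rw [Set.Icc.coe_one, show (2 : ℝ) - 1 = 1 by norm_num, shellOfRadius_one]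

theorem FreelyHomotopic.homotopic_shell {p : Path x y} {f : GenLoop (Fin l) X x}
    {g : GenLoop (Fin l) X y} (h : FreelyHomotopic p f g) : GenLoop.Homotopic f (shell p g) := by
  obtain ⟨H, hH⟩ := h
  refine (freelyHomotopic_shell (Path.refl x) f).homotopic.symm.trans ?_
  -- At time `s` the inner cube carries `H s`, and the shell carries `p` restricted to `[0, s]`.
  refine ⟨⟨⟨⟨fun a => if cubeRad a.2 ≤ 1 / 2 then H (a.1, cubeInner a.2)
    else p (a.1 * cubeOuter a.2), ?_⟩, fun t => ?_, fun t => ?_⟩, fun s t ht => ?_⟩⟩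
  · refine continuous_shell (fun s u => p (s * u)) (fun s t => H (s, t))
      (p.continuous.comp (continuous_fst.mul continuous_snd)) H.continuous fun s t ht => ?_
    rw [mul_one]
    exact hH s t ht
  · change (if _ then _ else _) = if _ then _ else _
    simp only [H.apply_zero, zero_mul, p.source]
    rfl
  · change (if _ then _ else _) = if _ then _ else _
    simp only [H.apply_one, one_mul]
    rfl
  · change (if _ then _ else _) = shell (Path.refl x) f t
    rw [shell_of_mem_boundary _ _ ht]
    simp only [cubeRad_eq_one_of_mem_boundary ht, cubeOuter_of_mem_boundary ht, mul_zero, p.source]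
    exact if_neg (by norm_num)

theorem exists_genLoop_mk (f : π_ l X x) :
    ∃ f' : GenLoop (Fin l) X x, (Quotient.mk _ f' : π_ l X x) = f :=
  Quotient.exists_rep f

theorem exists_genLoopFamily_mk {ι : Type*} {Z : ι → Type*} [∀ i, TopologicalSpace (Z i)]
    {b : ∀ i, Z i} (g : ∀ i, π_ l (Z i) (b i)) :
    ∃ g' : ∀ i, GenLoop (Fin l) (Z i) (b i), g = fun i => Quotient.mk _ (g' i) := by
  choose g' hg' using fun i => exists_genLoop_mk (g i)
  exact ⟨g', funext fun i => (hg' i).symm⟩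

theorem transportPi_refl (f : π_ l X x) : transportPi (.refl x) f = f := by
  obtain ⟨f, rfl⟩ := exists_genLoop_mk f
  exact Quotient.sound (freelyHomotopic_shell (Path.refl x) f).homotopic

theorem transportPi_trans (p : Path.Homotopic.Quotient x y) (q : Path.Homotopic.Quotient y z)
    (f : π_ l X z) : transportPi (p.trans q) f = transportPi p (transportPi q f) := by
  obtain ⟨f, rfl⟩ := exists_genLoop_mk f
  obtain ⟨p, rfl⟩ := Path.Homotopic.Quotient.mk_surjective p
  obtain ⟨q, rfl⟩ := Path.Homotopic.Quotient.mk_surjective q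
  exact Quotient.sound ((freelyHomotopic_shell p (shell q f)).trans
    (freelyHomotopic_shell q f)).homotopic_shell.symm

theorem piMap_transportPi (g : C(X, Y)) (p : Path.Homotopic.Quotient x y) (f : π_ l X y) :
    piMap g x (transportPi p f) = transportPi (p.map g) (piMap g y f) := by
  obtain ⟨f, rfl⟩ := exists_genLoop_mk f
  obtain ⟨p, rfl⟩ := Path.Homotopic.Quotient.mk_surjective p
  exact congrArg (Quotient.mk _) (GenLoop.ext _ _ fun t => apply_ite g _ _ _)

theorem subsingleton_pi {X : Type u} [TopologicalSpace X] [Subsingleton X] (l : ℕ) (x : X) :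
    Subsingleton (π_ l X x) := ⟨fun f g => by
  obtain ⟨f, rfl⟩ := exists_genLoop_mk f
  obtain ⟨g, rfl⟩ := exists_genLoop_mk g
  exact congrArg _ (GenLoop.ext _ _ fun _ => Subsingleton.elim _ _)⟩

/-- Equality of elements of homotopy groups whose basepoints agree only propositionally. -/
inductive SamePi : ∀ {x x' : X}, π_ l X x → π_ l X x' → Prop
  | refl {x : X} (f : π_ l X x) : SamePi f f

namespace SamePi

variable {x' y' x'' : X}

theorem eq {f g : π_ l X x} (h : SamePi f g) : f = g := by
  cases h; rfl

theorem of_eq {f g : π_ l X x} (h : f = g) : SamePi f g := h ▸ .refl _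

theorem symm {f : π_ l X x} {g : π_ l X x'} (h : SamePi f g) : SamePi g f := by
  cases h; exact .refl _

theorem trans {f : π_ l X x} {g : π_ l X x'} {k : π_ l X x''} (h : SamePi f g)
    (h' : SamePi g k) : SamePi f k := by
  cases h; exact h'

theorem basepoint_eq {f : π_ l X x} {g : π_ l X x'} (h : SamePi f g) : x = x' := by
  cases h; rfl

theorem mk {f : GenLoop (Fin l) X x} {g : GenLoop (Fin l) X x'} (hx : x = x')
    (h : ∀ t, f t = g t) : SamePi (l := l) (Quotient.mk _ f) (Quotient.mk _ g) := by
  subst hx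
  exact of_eq (congrArg _ (GenLoop.ext _ _ h))

theorem exists_of_eq (f : π_ l X x) (hx : x = x') : ∃ g : π_ l X x', SamePi f g := by
  subst hx
  exact ⟨f, .refl _⟩

theorem map {f : π_ l X x} {f' : π_ l X x'} (h : SamePi f f') (g : C(X, Y)) :
    SamePi (piMap g x f) (piMap g x' f') := by
  cases h; exact .refl _

theorem map_of_forall_eq (f : π_ l X x) {g : C(X, X)} (hg : ∀ z, g z = z) :
    SamePi (piMap g x f) f := by
  obtain ⟨f, rfl⟩ := exists_genLoop_mk f
  exact mk (hg x) fun t => hg (f t)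

theorem transport {p : Path.Homotopic.Quotient x y} {p' : Path.Homotopic.Quotient x' y'}
    {f : π_ l X y} {f' : π_ l X y'} (hp : SamePath p p') (hf : SamePi f f') :
    SamePi (transportPi p f) (transportPi p' f') := by
  cases hp
  exact of_eq (congrArg _ hf.eq)

end SamePi

end FreeHomotopy

/-! ### Blocks and the symmetric groups operad -/

section Blocks

variable {k N M : ℕ} (m : Fin k → ℕ) (h : N = ∑ i, m i)

theorem coe_eq_of_forall_lt_imp_lt {A : Type*} (f : A ≃ Fin M) (g : A → Fin M)
    (hfg : ∀ a b, f a < f b → g a < g b) : ⇑f = g := by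
  have hmono : StrictMono (g ∘ f.symm) := fun p q hpq => hfg _ _ (by simpa using hpq)
  have hid : g ∘ f.symm = id := by
    refine (StrictMono.range_inj hmono strictMono_id).1 ?_
    rw [(Finite.injective_iff_surjective.1 hmono.injective).range_eq, Set.range_id]
  funext a
  simpa using (congrFun hid (f a)).symm

variable (n : Fin N → ℕ) (hM : M = ∑ p, n p) (s : Fin k → ℕ)
  (hs : ∀ i, s i = ∑ j, n (blk m h ⟨i, j⟩)) (hM' : M = ∑ i, s i)

/-- Both sides enumerate the triples `(i, j, l)` by `Fin M` in lexicographic order, and there is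
only one order-preserving enumeration. -/
theorem blk_assoc (i : Fin k) (j : Fin (m i)) (l : Fin (n (blk m h ⟨i, j⟩))) :
    blk n hM ⟨blk m h ⟨i, j⟩, l⟩ =
      blk s hM' ⟨i, blk (fun j => n (blk m h ⟨i, j⟩)) (hs i) ⟨j, l⟩⟩ := by
  let f : (Σ i, Σ j, Fin (n (blk m h ⟨i, j⟩))) ≃ Fin M :=
    (Equiv.sigmaAssoc fun i j => Fin (n (blk m h ⟨i, j⟩))).symm.trans
      ((Equiv.sigmaCongrLeft (β := fun p => Fin (n p)) (blk m h)).trans (blk n hM))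
  let g : (Σ i, Σ j, Fin (n (blk m h ⟨i, j⟩))) → Fin M := fun x =>
    blk s hM' ⟨x.1, blk (fun j => n (blk m h ⟨x.1, j⟩)) (hs x.1) x.2⟩
  suffices hfg : ∀ x y, f x < f y → g x < g y from
    congrFun (coe_eq_of_forall_lt_imp_lt f g hfg) ⟨i, j, l⟩
  rintro ⟨i, j, l⟩ ⟨i', j', l'⟩ hlt
  change blk n hM ⟨blk m h ⟨i, j⟩, l⟩ < blk n hM ⟨blk m h ⟨i', j'⟩, l'⟩ at hlt
  rcases lt_trichotomy i i' with hi | rfl | hi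
  · exact blk_lt _ _ hi _ _
  · refine (blk_lt_iff_snd _ _ _ _ _).2 ?_
    rcases lt_trichotomy j j' with hj | rfl | hj
    · exact blk_lt _ _ hj _ _
    · rwa [blk_lt_iff_snd] at hlt ⊢
    · exact absurd hlt (blk_lt _ _ ((blk_lt_iff_snd _ _ _ _ _).2 hj) _ _).not_gt
  · exact absurd hlt (blk_lt _ _ (blk_lt _ _ hi _ _) _ _).not_gt

theorem blk_congr {m' : Fin k → ℕ} (hm : ∀ i, m i = m' i) (h' : N = ∑ i, m' i)
    (i : Fin k) (j : Fin (m i)) : blk m h ⟨i, j⟩ = blk m' h' ⟨i, j.cast (hm i)⟩ := by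
  obtain rfl : m = m' := funext hm
  rfl

theorem blk_single (h : N = ∑ _i : Fin 1, N) (i : Fin 1) (j : Fin N) :
    blk (fun _ => N) h ⟨i, j⟩ = j := by
  obtain rfl := Subsingleton.elim i 0
  exact Fin.ext ((finSigmaFinEquiv_apply (n := fun _ : Fin 1 => N) ⟨0, j⟩).trans (by simp))

theorem blk_ones (h : k = ∑ _i : Fin k, 1) (i : Fin k) (j : Fin 1) :
    blk (fun _ => 1) h ⟨i, j⟩ = i := by
  obtain rfl := Subsingleton.elim j 0
  exact Fin.ext ((finSigmaFinEquiv_apply (n := fun _ : Fin k => 1) ⟨i, 0⟩).trans (by simp))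

theorem SG.ext_symm {σ τ : SG k} (hστ : ∀ i, σ.unop.symm i = τ.unop.symm i) : σ = τ :=
  MulOpposite.unop_injective (Equiv.symm_bijective.injective (Equiv.ext hστ))

variable (a : SG k) (b : ∀ i, SG (m i))

theorem symComp_symm_apply (i : Fin k) (j : Fin (m (a.unop.symm i))) :
    (symComp m h a b).unop.symm (blk (fun i => m (a.unop.symm i)) (sum_perm_eq h a.unop) ⟨i, j⟩) =
      blk m h ⟨a.unop.symm i, (b (a.unop.symm i)).unop.symm j⟩ := by
  rw [Equiv.symm_apply_eq]
  simp only [symComp, MulOpposite.unop_op, Equiv.trans_apply, Equiv.symm_apply_apply]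
  congr 1
  rw [← Equiv.symm_apply_eq]
  simp [Equiv.sigmaCongrLeft']

variable {n s}

theorem sum_symComp_symm (i : Fin k)
    (hs : s (a.unop.symm i) = ∑ j, n (blk m h ⟨a.unop.symm i, j⟩)) :
    s (a.unop.symm i) = ∑ j, n ((symComp m h a b).unop.symm
      (blk (fun i => m (a.unop.symm i)) (sum_perm_eq h a.unop) ⟨i, j⟩)) := by
  simp only [symComp_symm_apply, hs]
  exact (Equiv.sum_comp (b (a.unop.symm i)).unop.symm fun j => n (blk m h ⟨_, j⟩)).symm

theorem symComp_assoc (c : ∀ p, SG (n p)) :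
    symComp n hM (symComp m h a b) c =
      symComp s hM' a (fun i => symComp (fun j => n (blk m h ⟨i, j⟩)) (hs i) (b i)
        (fun j => c (blk m h ⟨i, j⟩))) := by
  refine SG.ext_symm fun q => ?_
  obtain ⟨⟨p, l⟩, rfl⟩ := (blk _ (sum_perm_eq hM (symComp m h a b).unop)).surjective q
  obtain ⟨⟨i, j⟩, rfl⟩ := (blk _ (sum_perm_eq h a.unop)).surjective p
  have hinput := symComp_symm_apply m h a b i
  have hsize := fun j => congrArg n (hinput j)
  have hsource : (⟨_, l⟩ : Σ p, Fin (n p)) = ⟨blk m h ⟨_, (b _).unop.symm j⟩, l.cast (hsize j)⟩ :=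
    Sigma.ext (hinput j) ((Fin.heq_ext_iff (hsize j)).2 rfl)
  have htarget := blk_assoc (fun i => m (a.unop.symm i)) (sum_perm_eq h a.unop)
    (fun p => n ((symComp m h a b).unop.symm p)) (sum_perm_eq hM _)
    (fun i => s (a.unop.symm i)) (fun i => sum_symComp_symm m h a b i (hs _))
    (sum_perm_eq hM' a.unop) i j l
  rw [blk_congr _ _ hsize (sum_perm_eq (hs (a.unop.symm i)) (b (a.unop.symm i)).unop)] at htarget
  rw [symComp_symm_apply, htarget]
  refine Eq.trans ?_ (symComp_symm_apply s hM' a _ i _).symm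
  rw [symComp_symm_apply (fun j => n (blk m h ⟨a.unop.symm i, j⟩)), ← blk_assoc m h n hM]
  exact congrArg (fun z : (Σ p, Fin (n p)) => blk n hM ⟨z.1, (c z.1).unop.symm z.2⟩) hsource

theorem symComp_single (h : N = ∑ _i : Fin 1, N) (a : SG N) :
    symComp (fun _ : Fin 1 => N) h 1 (fun _ => a) = a := SG.ext_symm fun q => by
  obtain ⟨⟨i, j⟩, rfl⟩ := (blk _ h).surjective q
  have hq := symComp_symm_apply (fun _ => N) h 1 (fun _ => a) i j
  rw [blk_single, blk_single] at hq
  rwa [blk_single]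

theorem symComp_ones (h : k = ∑ _i : Fin k, 1) :
    symComp (fun _ : Fin k => 1) h a (fun _ => 1) = a := SG.ext_symm fun q => by
  obtain ⟨⟨i, j⟩, rfl⟩ := (blk _ h).surjective q
  have hq := symComp_symm_apply (fun _ => 1) h a (fun _ => 1) i j
  rw [blk_ones, blk_ones] at hq
  rwa [blk_ones]

theorem symComp_one : symComp m h 1 (fun _ => 1) = 1 := SG.ext_symm fun q => by
  obtain ⟨⟨i, j⟩, rfl⟩ := (blk m h).surjective q
  exact symComp_symm_apply m h 1 (fun _ => 1) i j

theorem symComp_mul (a' : SG k) (b' : ∀ i, SG (m i)) :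
    symComp m h (a * a') (fun i => b i * b' i) =
      symComp m h a b * symComp (fun i => m (a.unop.symm i)) (sum_perm_eq h a.unop) a'
        (fun i => b' (a.unop.symm i)) := SG.ext_symm fun q => by
  obtain ⟨⟨i, j⟩, rfl⟩ := (blk _ (sum_perm_eq h (a * a').unop)).surjective q
  refine (symComp_symm_apply m h (a * a') (fun i => b i * b' i) i j).trans ?_
  have hinner := symComp_symm_apply (fun i => m (a.unop.symm i)) (sum_perm_eq h a.unop) a'
    (fun i => b' (a.unop.symm i)) i j
  exact (symComp_symm_apply m h a b (a'.unop.symm i) ((b' _).unop.symm j)).symm.trans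
    (congrArg (symComp m h a b).unop.symm hinner.symm)

theorem isGroupOperad_symOps : IsGroupOperad symOps (fun _ σ => σ) where
  isOperad :=
    { zero_unique := ⟨⟨⟨1⟩, fun _ => SG.ext_symm fun i => i.elim0⟩⟩
      assoc m _ h _ _ hM _ hs hM' a b c := symComp_assoc m h hM hs hM' a b c
      one_comp := symComp_single
      comp_one h a := symComp_ones a h }
  map_mul _ _ := rfl
  map_unit := rfl
  map_comp _ _ _ _ _ := rfl
  unit_eq := rfl
  crossed m _ h a a' b b' := symComp_mul m h a b a' b'

end Blocks

/-! ### The operad `(𝒞₁)₀` -/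

namespace C10

variable {k : ℕ}

theorem ext {c c' : C10 k} (h : ∀ p, c.1.1 p = c'.1.1 p) : c = c' :=
  Subtype.ext (Subtype.ext (funext h))

theorem comp_blk (m : Fin k → ℕ) {N : ℕ} (h : N = ∑ i, m i) (c : C10 k)
    (b : ∀ i, C10 (m i)) (q : Σ i, Fin (m i)) :
    (ops.comp m h c b).1.1 (blk m h q) =
      ((c.1.1 q.1).1 + ((c.1.1 q.1).2 - (c.1.1 q.1).1) * ((b q.1).1.1 q.2).1,
        (c.1.1 q.1).1 + ((c.1.1 q.1).2 - (c.1.1 q.1).1) * ((b q.1).1.1 q.2).2) := by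
  conv_rhs => rw [← (blk m h).symm_apply_apply q]
  rfl

theorem ops_one_apply (i : Fin 1) : ops.one.1.1 i = (0, 1) := by
  obtain rfl := Subsingleton.elim i 0
  simp [ops, std, LittleIntervals.std, LittleIntervals.ofOrdered]

theorem isOperad_ops : ops.IsOperad where
  zero_unique := ⟨⟨⟨std 0⟩, fun _ => ext fun p => p.elim0⟩⟩
  assoc m N h n M hM s hs hM' a b c := ext fun q => by
    obtain ⟨⟨p, l⟩, rfl⟩ := (blk n hM).surjective q
    obtain ⟨⟨i, j⟩, rfl⟩ := (blk m h).surjective p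
    rw [comp_blk, blk_assoc m h n hM s hs hM', comp_blk, comp_blk, comp_blk]
    ext <;> ring
  one_comp h a := ext fun q => by
    obtain ⟨⟨i, j⟩, rfl⟩ := (blk _ h).surjective q
    rw [comp_blk, blk_single, ops_one_apply]
    ext <;> simp
  comp_one h a := ext fun q => by
    obtain ⟨⟨i, j⟩, rfl⟩ := (blk _ h).surjective q
    rw [comp_blk, blk_ones, ops_one_apply]
    ext <;> simp

theorem continuous_interval (i : Fin k) : Continuous fun c : C10 k => c.1.1 i :=
  (continuous_apply i).comp (continuous_subtype_val.comp continuous_subtype_val)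

theorem continuous_iff {K : Type*} [TopologicalSpace K] {c : K → C10 k} :
    Continuous c ↔ ∀ i, Continuous fun x => (c x).1.1 i := by
  refine ⟨fun hc i => (continuous_interval i).comp hc, fun hc => ?_⟩
  exact .subtype_mk (.subtype_mk (continuous_pi hc) _) _

/-- `(𝒞₁)₀` as a topological operad. -/
noncomputable def topOperad : TopOperad.{0} where
  obj := C10
  ops := ops
  isOperad := isOperad_ops
  continuous_comp m N h K _ _ _ a b ha hb := continuous_iff.2 fun p => by
    have ha' := (continuous_interval ((blk m h).symm p).1).comp ha
    have hb' := (continuous_interval ((blk m h).symm p).2).comp (hb _)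
    simp only [Function.comp_def] at ha' hb'
    change Continuous fun x => (_, _)
    fun_prop

theorem continuous_linPath : Continuous fun x : C10 k × C10 k × unitInterval =>
    linPath x.1 x.2.1 x.2.2 := continuous_iff.2 fun i => by
  have hsource : Continuous fun x : C10 k × C10 k × unitInterval => x.1.1.1 i :=
    (continuous_interval i).comp continuous_fst
  have htarget : Continuous fun x : C10 k × C10 k × unitInterval => x.2.1.1.1 i :=
    (continuous_interval i).comp (continuous_fst.comp continuous_snd)
  change Continuous fun x : C10 k × C10 k × unitInterval => (_, _)
  fun_prop

instance : ContractibleSpace (C10 k) := by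
  refine (contractible_iff_id_nullhomotopic _).2 ⟨std k, ⟨⟨⟨fun x => linPath x.2 (std k) x.1, ?_⟩,
    fun c => (linPath c (std k)).source, fun c => (linPath c (std k)).target⟩⟩⟩
  exact continuous_linPath.comp
    (f := fun x : unitInterval × C10 k => (x.2, std k, x.1)) (by fun_prop)

/-- The composite `γ(c_k; c_{m₁}, …, c_{m_k})`. -/
noncomputable def stdComp (m : Fin k → ℕ) {N : ℕ} (h : N = ∑ i, m i) : C10 N :=
  ops.comp m h (std k) (fun i => std (m i))

theorem stdComp_congr {m m' : Fin k → ℕ} (hm : ∀ i, m i = m' i) {N : ℕ} (h : N = ∑ i, m i)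
    (h' : N = ∑ i, m' i) : stdComp m h = stdComp m' h' := by
  obtain rfl : m = m' := funext hm
  rfl

/-- Both sides are `γ(γ(c_k; c_{m₁}, …); c_{n₁}, …)` with the inputs permuted by `symComp m h σ τ`,
bracketed in the two possible ways. -/
theorem comp_stdComp_std {m : Fin k → ℕ} {N : ℕ} {h : N = ∑ i, m i} {σ : SG k}
    {τ : ∀ i, SG (m i)} {ω : SG N} (hω : ω = symComp m h σ τ) {n : Fin N → ℕ} {M : ℕ}
    (hM : M = ∑ p, n p) {s : Fin k → ℕ} (hs : ∀ i, s i = ∑ j, n (blk m h ⟨i, j⟩))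
    (hM' : M = ∑ i, s i) :
    ops.comp (fun p => n (ω.unop.symm p)) (sum_perm_eq hM _)
        (stdComp (fun i => m (σ.unop.symm i)) (sum_perm_eq h _))
        (fun p => std (n (ω.unop.symm p))) =
      ops.comp (fun i => s (σ.unop.symm i)) (sum_perm_eq hM' _) (std k)
        (fun i => stdComp (fun j => n (blk m h ⟨σ.unop.symm i, (τ (σ.unop.symm i)).unop.symm j⟩))
          (sum_perm_eq (hs _) _)) := by
  subst hω
  refine (isOperad_ops.assoc _ _ _ _ (fun i => s (σ.unop.symm i))
    (fun i => sum_symComp_symm m h σ τ i (hs _)) (sum_perm_eq hM' _) _ _ _).trans ?_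
  exact congrArg (ops.comp _ _ _) (funext fun i =>
    stdComp_congr (fun j => congrArg n (symComp_symm_apply m h σ τ i j)) _ _)

end C10

/-! ### Composition of classes of paths and spheres in a topological operad -/

namespace TopOperad

variable (C : TopOperad.{u}) {k : ℕ} (m : Fin k → ℕ) {N : ℕ} (h : N = ∑ i, m i)
  {a a' a'' : C.obj k} {b b' b'' : ∀ i, C.obj (m i)} {l : ℕ}

theorem pathCompQ_trans (p : Path.Homotopic.Quotient a a') (p' : Path.Homotopic.Quotient a' a'')
    (q : ∀ i, Path.Homotopic.Quotient (b i) (b' i))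
    (q' : ∀ i, Path.Homotopic.Quotient (b' i) (b'' i)) :
    C.pathCompQ m h (p.trans p') (fun i => (q i).trans (q' i)) =
      (C.pathCompQ m h p q).trans (C.pathCompQ m h p' q') := by
  obtain ⟨p, rfl⟩ := Path.Homotopic.Quotient.mk_surjective p
  obtain ⟨p', rfl⟩ := Path.Homotopic.Quotient.mk_surjective p'
  obtain ⟨q, rfl⟩ := exists_pathFamily_mk q
  obtain ⟨q', rfl⟩ := exists_pathFamily_mk q'
  simp only [← Path.Homotopic.Quotient.mk_trans, C.pathCompQ_mk]
  congr 1
  ext t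
  simp only [pathComp, Path.trans_apply, Path.coe_mk_mk]
  split_ifs <;> rfl

variable {C} in
theorem samePath_pathCompQ {c c' : C.obj k} {d d' : ∀ i, C.obj (m i)}
    {p : Path.Homotopic.Quotient a a'} {p' : Path.Homotopic.Quotient c c'}
    {q : ∀ i, Path.Homotopic.Quotient (b i) (b' i)}
    {q' : ∀ i, Path.Homotopic.Quotient (d i) (d' i)}
    (hp : SamePath p p') (hq : ∀ i, SamePath (q i) (q' i)) :
    SamePath (C.pathCompQ m h p q) (C.pathCompQ m h p' q') := by
  cases hp
  obtain rfl : b = d := funext fun i => (SamePath.iff_exists_eq_cast.1 (hq i)).1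
  obtain rfl : b' = d' := funext fun i => (SamePath.iff_exists_eq_cast.1 (hq i)).2.1
  obtain rfl : q = q' := funext fun i => (hq i).eq
  exact .refl _

theorem loopCompQ_transportPi (p : Path.Homotopic.Quotient a a')
    (q : ∀ i, Path.Homotopic.Quotient (b i) (b' i)) (f : π_ l (C.obj k) a')
    (g : ∀ i, π_ l (C.obj (m i)) (b' i)) :
    C.loopCompQ m h (transportPi p f) (fun i => transportPi (q i) (g i)) =
      transportPi (C.pathCompQ m h p q) (C.loopCompQ m h f g) := by
  obtain ⟨p, rfl⟩ := Path.Homotopic.Quotient.mk_surjective p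
  obtain ⟨q, rfl⟩ := exists_pathFamily_mk q
  obtain ⟨f, rfl⟩ := exists_genLoop_mk f
  obtain ⟨g, rfl⟩ := exists_genLoopFamily_mk g
  change C.loopCompQ m h (.mk _ (shell p f)) (fun i => .mk _ (shell (q i) (g i))) = _
  simp only [C.pathCompQ_mk, C.loopCompQ_mk]
  refine congrArg (Quotient.mk _) (GenLoop.ext _ _ fun t => ?_)
  change C.ops.comp m h (if cubeRad t ≤ 1 / 2 then _ else _)
    (fun i => if cubeRad t ≤ 1 / 2 then _ else _) =
    if cubeRad t ≤ 1 / 2 then C.ops.comp m h _ _ else C.ops.comp m h _ _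
  split_ifs <;> rfl

variable {C} in
theorem samePi_loopCompQ {c : C.obj k} {d : ∀ i, C.obj (m i)}
    {f : π_ l (C.obj k) a} {f' : π_ l (C.obj k) c}
    {g : ∀ i, π_ l (C.obj (m i)) (b i)} {g' : ∀ i, π_ l (C.obj (m i)) (d i)}
    (hf : SamePi f f') (hg : ∀ i, SamePi (g i) (g' i)) :
    SamePi (C.loopCompQ m h f g) (C.loopCompQ m h f' g') := by
  cases hf
  obtain rfl : b = d := funext fun i => (hg i).basepoint_eq
  obtain rfl : g = g' := funext fun i => (hg i).eq
  exact .refl _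

theorem samePath_assoc (n : Fin N → ℕ) {M : ℕ} (hM : M = ∑ p, n p)
    (s : Fin k → ℕ) (hs : ∀ i, s i = ∑ j, n (blk m h ⟨i, j⟩)) (hM' : M = ∑ i, s i)
    {c c' : ∀ p, C.obj (n p)} (p : Path.Homotopic.Quotient a a')
    (q : ∀ i, Path.Homotopic.Quotient (b i) (b' i))
    (r : ∀ j, Path.Homotopic.Quotient (c j) (c' j)) :
    SamePath (C.pathCompQ n hM (C.pathCompQ m h p q) r)
      (C.pathCompQ s hM' p (fun i => C.pathCompQ (fun j => n (blk m h ⟨i, j⟩)) (hs i) (q i)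
        (fun j => r (blk m h ⟨i, j⟩)))) := by
  obtain ⟨p, rfl⟩ := Path.Homotopic.Quotient.mk_surjective p
  obtain ⟨q, rfl⟩ := exists_pathFamily_mk q
  obtain ⟨r, rfl⟩ := exists_pathFamily_mk r
  simp only [C.pathCompQ_mk]
  exact .mk fun t => C.isOperad.assoc m h n hM s hs hM' _ _ _

theorem samePi_assoc (n : Fin N → ℕ) {M : ℕ} (hM : M = ∑ p, n p)
    (s : Fin k → ℕ) (hs : ∀ i, s i = ∑ j, n (blk m h ⟨i, j⟩)) (hM' : M = ∑ i, s i)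
    {c : ∀ p, C.obj (n p)} (f : π_ l (C.obj k) a) (g : ∀ i, π_ l (C.obj (m i)) (b i))
    (r : ∀ j, π_ l (C.obj (n j)) (c j)) :
    SamePi (C.loopCompQ n hM (C.loopCompQ m h f g) r)
      (C.loopCompQ s hM' f (fun i => C.loopCompQ (fun j => n (blk m h ⟨i, j⟩)) (hs i) (g i)
        (fun j => r (blk m h ⟨i, j⟩)))) := by
  obtain ⟨f, rfl⟩ := exists_genLoop_mk f
  obtain ⟨g, rfl⟩ := exists_genLoopFamily_mk g
  obtain ⟨r, rfl⟩ := exists_genLoopFamily_mk r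
  simp only [C.loopCompQ_mk]
  exact .mk (C.isOperad.assoc m h n hM s hs hM' _ _ _)
    fun t => C.isOperad.assoc m h n hM s hs hM' _ _ _

theorem samePath_one_comp (h : k = ∑ _i : Fin 1, k) (p : Path.Homotopic.Quotient a a') :
    SamePath (C.pathCompQ (fun _ : Fin 1 => k) h (.refl C.ops.one) (fun _ => p)) p := by
  obtain ⟨p, rfl⟩ := Path.Homotopic.Quotient.mk_surjective p
  rw [← Path.Homotopic.Quotient.mk_refl, C.pathCompQ_mk (fun _ => k) h _ (fun _ => p)]
  exact .mk fun t => C.isOperad.one_comp h _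

theorem samePath_comp_one (h : k = ∑ _i : Fin k, 1) (p : Path.Homotopic.Quotient a a') :
    SamePath (C.pathCompQ (fun _ : Fin k => 1) h p (fun _ => .refl C.ops.one)) p := by
  obtain ⟨p, rfl⟩ := Path.Homotopic.Quotient.mk_surjective p
  simp only [← Path.Homotopic.Quotient.mk_refl]
  rw [C.pathCompQ_mk (fun _ => 1) h p (fun _ => Path.refl _)]
  exact .mk fun t => C.isOperad.comp_one h _

theorem samePi_one_comp (h : k = ∑ _i : Fin 1, k) (f : π_ l (C.obj k) a) :
    SamePi (C.loopCompQ (fun _ : Fin 1 => k) h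
      (Quotient.mk _ (GenLoop.const : GenLoop (Fin l) _ C.ops.one)) (fun _ => f)) f := by
  obtain ⟨f, rfl⟩ := exists_genLoop_mk f
  rw [C.loopCompQ_mk (fun _ => k) h _ (fun _ => f)]
  exact .mk (C.isOperad.one_comp h _) fun t => C.isOperad.one_comp h _

theorem samePi_comp_one (h : k = ∑ _i : Fin k, 1) (f : π_ l (C.obj k) a) :
    SamePi (C.loopCompQ (fun _ : Fin k => 1) h f
      (fun _ => Quotient.mk _ (GenLoop.const : GenLoop (Fin l) _ C.ops.one))) f := by
  obtain ⟨f, rfl⟩ := exists_genLoop_mk f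
  rw [C.loopCompQ_mk (fun _ => 1) h f (fun _ => GenLoop.const)]
  exact .mk (C.isOperad.comp_one h _) fun t => C.isOperad.comp_one h _

end TopOperad

/-! ### The canonical paths between the points of the image of `(𝒞₁)₀` -/

namespace GoodBasepoint

variable {C : TopOperad.{u}} (E : GoodBasepoint C) {k : ℕ}

/-- The class of the image of the linear path from `c` to `c'`. -/
noncomputable def lin (c c' : C10 k) : Path.Homotopic.Quotient (E.η k c) (E.η k c') :=
  .mk ((C10.linPath c c').map (E.continuous_η k))

theorem mk_map_eq_lin {c c' : C10 k} (p : Path c c') :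
    Path.Homotopic.Quotient.mk (p.map (E.continuous_η k)) = E.lin c c' :=
  Path.Homotopic.Quotient.eq.2
    ((SimplyConnectedSpace.paths_homotopic p (C10.linPath c c')).map ⟨_, E.continuous_η k⟩)

theorem lin_trans (c c' c'' : C10 k) : (E.lin c c').trans (E.lin c' c'') = E.lin c c'' := by
  rw [← E.mk_map_eq_lin ((C10.linPath c c').trans (C10.linPath c' c'')), Path.map_trans]
  rfl

theorem lin_self (c : C10 k) : E.lin c c = .refl _ :=
  (E.mk_map_eq_lin (Path.refl c)).symm

theorem lin_symm (c c' : C10 k) : (E.lin c c').symm = E.lin c' c :=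
  E.mk_map_eq_lin (C10.linPath c c').symm

variable (m : Fin k → ℕ) {N : ℕ} (h : N = ∑ i, m i)

theorem samePath_δ :
    SamePath (Path.Homotopic.Quotient.mk (E.δ m h)) (E.lin (C10.std N) (C10.stdComp m h)) :=
  .mk fun _ => rfl

theorem samePath_pathCompQ_lin (c c' : C10 k) (d d' : ∀ i, C10 (m i)) :
    SamePath (C.pathCompQ m h (E.lin c c') (fun i => E.lin (d i) (d' i)))
      (E.lin (C10.ops.comp m h c d) (C10.ops.comp m h c' d')) := by
  let p : Path (C10.ops.comp m h c d) (C10.ops.comp m h c' d') :=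
    C10.topOperad.pathComp m h (C10.linPath c c') (fun i => C10.linPath (d i) (d' i))
  rw [← E.mk_map_eq_lin p]
  unfold lin
  rw [C.pathCompQ_mk m h _ (fun i => (C10.linPath (d i) (d' i)).map (E.continuous_η _))]
  exact .mk fun t => (E.map_comp m h _ _).symm

end GoodBasepoint

/-! ### Transport of operad structures -/

theorem OperadOps.IsOperad.transport {C : ℕ → Type u} {D : ℕ → Type v} {O : OperadOps C}
    (hO : O.IsOperad) (e : ∀ n, C n ≃ D n) : (O.transport e).IsOperad where
  zero_unique := hO.zero_unique.map fun u => @Equiv.unique _ _ u (e 0).symm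
  assoc m N h n M hM s hs hM' a b c := by
    simp only [OperadOps.transport, Equiv.symm_apply_apply]
    rw [hO.assoc m h n hM s hs hM']
  one_comp h a := by
    simp only [OperadOps.transport, Equiv.symm_apply_apply]
    rw [hO.one_comp h, Equiv.apply_symm_apply]
  comp_one h a := by
    simp only [OperadOps.transport, Equiv.symm_apply_apply]
    rw [hO.comp_one h, Equiv.apply_symm_apply]

theorem OperadOps.transport_eq_of_map {C : ℕ → Type u} {D : ℕ → Type v} {O : OperadOps C}
    {O' : OperadOps D} (e : ∀ n, C n ≃ D n) (hone : e 1 O.one = O'.one)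
    (hcomp : ∀ {k : ℕ} (m : Fin k → ℕ) {N : ℕ} (h : N = ∑ i, m i) (a : C k) (b : ∀ i, C (m i)),
      e N (O.comp m h a b) = O'.comp m h (e k a) (fun i => e (m i) (b i))) :
    O.transport e = O' := by
  cases O'
  simp only [OperadOps.transport, hone, hcomp, Equiv.apply_symm_apply]

/-! ### The action of group elements on classes of paths and spheres -/

section SMul

variable {M X : Type*} [TopologicalSpace X] {x y z x' y' : X} {l : ℕ}

section

variable [SMul M X] [ContinuousConstSMul M X]

/-- Multiplication by a fixed element of `M` as a continuous map. -/
def smulMap (σ : M) : C(X, X) := ⟨fun z => σ • z, continuous_const_smul σ⟩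

/-- The action of `M` on homotopy classes of paths. -/
noncomputable def smulPath (σ : M) (p : Path.Homotopic.Quotient x y) :
    Path.Homotopic.Quotient (σ • x) (σ • y) := p.map (smulMap σ)

/-- The action of `M` on homotopy classes of spheres, which moves the basepoint. -/
def smulPi (σ : M) (f : π_ l X x) : π_ l X (σ • x) := piMap (smulMap σ) x f

theorem SamePath.smul {p : Path.Homotopic.Quotient x y} {p' : Path.Homotopic.Quotient x' y'}
    (h : SamePath p p') (σ : M) : SamePath (smulPath σ p) (smulPath σ p') := h.map _

theorem SamePi.smul {f : π_ l X x} {f' : π_ l X x'} (h : SamePi f f') (σ : M) :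
    SamePi (smulPi σ f) (smulPi σ f') := h.map _

theorem smulPath_trans (σ : M) (p : Path.Homotopic.Quotient x y)
    (q : Path.Homotopic.Quotient y z) :
    smulPath σ (p.trans q) = (smulPath σ p).trans (smulPath σ q) :=
  quotient_map_trans p q _

theorem smulPath_refl (σ : M) (x : X) :
    smulPath σ (Path.Homotopic.Quotient.refl x) = .refl (σ • x) := rfl

theorem smulPi_transportPi (σ : M) (p : Path.Homotopic.Quotient x y) (f : π_ l X y) :
    smulPi σ (transportPi p f) = transportPi (smulPath σ p) (smulPi σ f) :=
  piMap_transportPi _ p f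

end

theorem samePath_smulPath_smulPath [Monoid M] [MulAction M X] [ContinuousConstSMul M X] (σ τ : M)
    (p : Path.Homotopic.Quotient x y) :
    SamePath (smulPath σ (smulPath τ p)) (smulPath (σ * τ) p) := by
  obtain ⟨p, rfl⟩ := Path.Homotopic.Quotient.mk_surjective p
  exact .mk fun t => (mul_smul σ τ _).symm

end SMul

section Action

variable {C : TopOperad.{u}} {G : ℕ → Type w} [∀ n, Group (G n)]
  [∀ n, MulAction (G n) (C.obj n)] [∀ n, ContinuousConstSMul (G n) (C.obj n)]
  {P : OperadOps G} {π : ∀ n, G n → SG n}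
  (hC : IsGOperad P π C.ops (fun n (σ : G n) (x : C.obj n) => σ • x))
  {k : ℕ} (m : Fin k → ℕ) {N : ℕ} (h : N = ∑ i, m i) (σ : G k) (τ : ∀ i, G (m i))
  {a a' : C.obj k} {b b' : ∀ i, C.obj (m i)} {l : ℕ}

include hC in
theorem IsGOperad.samePath_equivariant (p : Path.Homotopic.Quotient a a')
    (q : ∀ i, Path.Homotopic.Quotient (b i) (b' i)) :
    SamePath (C.pathCompQ m h (smulPath σ p) (fun i => smulPath (τ i) (q i)))
      (smulPath (P.comp m h σ τ) (C.pathCompQ (fun i => m ((π k σ).unop.symm i))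
        (sum_perm_eq h _) p (fun i => q ((π k σ).unop.symm i)))) := by
  obtain ⟨p, rfl⟩ := Path.Homotopic.Quotient.mk_surjective p
  obtain ⟨q, rfl⟩ := exists_pathFamily_mk q
  rw [C.pathCompQ_mk _ _ p (fun i => q ((π k σ).unop.symm i))]
  refine (SamePath.of_eq (C.pathCompQ_mk m h _ _)).trans ?_
  exact .mk fun t => hC.equivariant m h σ τ _ _

include hC in
theorem IsGOperad.samePi_equivariant (f : π_ l (C.obj k) a) (g : ∀ i, π_ l (C.obj (m i)) (b i)) :
    SamePi (C.loopCompQ m h (smulPi σ f) (fun i => smulPi (τ i) (g i)))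
      (smulPi (P.comp m h σ τ)
        (C.loopCompQ (fun i => m ((π k σ).unop.symm i)) (sum_perm_eq h _) f
          (fun i => g ((π k σ).unop.symm i)))) := by
  obtain ⟨f, rfl⟩ := exists_genLoop_mk f
  obtain ⟨g, rfl⟩ := exists_genLoopFamily_mk g
  rw [C.loopCompQ_mk _ _ f (fun i => g ((π k σ).unop.symm i))]
  refine (SamePi.of_eq (C.loopCompQ_mk m h _ _)).trans ?_
  exact .mk (hC.equivariant m h σ τ _ _) fun t => hC.equivariant m h σ τ _ _

/-! ### The operad of path classes from the basepoints to points of their orbits -/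

namespace GoodBasepoint

variable (E : GoodBasepoint C)

variable (G) in
/-- Homotopy classes of paths from `e_k` to a point `σ e_k` of its `G_k`-orbit, recorded together
with `σ`. For `G = 𝒮` this is the set `L_k`, and for trivial groups it is `π₁(C(k), e_k)`. -/
abbrev OrbitPath (k : ℕ) : Type (max u w) :=
  Σ σ : G k, Path.Homotopic.Quotient (E.e k) (σ • E.e k)

/-- The operad operations of `{OrbitPath G k}`: `γ((σ, [f]); (τ₁, [g₁]), …)` is the class of
`δ₁ · γ(f; g₁, …) · γ(σ; τ₁, …)δ₂⁻¹`. -/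
noncomputable def orbitPathOps : OperadOps (E.OrbitPath G) where
  comp {k} m _ h x y :=
    ⟨P.comp m h x.1 (fun i => (y i).1),
      ((Path.Homotopic.Quotient.mk (E.δ m h)).trans
        (C.pathCompQ m h x.2 (fun i => (y i).2))).trans
        ((smulPath (P.comp m h x.1 (fun i => (y i).1)) (Path.Homotopic.Quotient.mk
            (E.δ (fun i => m ((π k x.1).unop.symm i)) (sum_perm_eq h (π k x.1).unop))).symm).cast
          (hC.equivariant m h x.1 (fun i => (y i).1) (E.e k) (fun i => E.e (m i)))
          rfl)⟩
  one := ⟨1, (Path.Homotopic.Quotient.refl (E.e 1)).cast rfl (one_smul _ _)⟩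

/-- The product `(σ, [f]) (τ, [g]) = (σ τ, [f · σ g])`. -/
noncomputable def orbitPathMul {k : ℕ} (x y : E.OrbitPath G k) : E.OrbitPath G k :=
  ⟨x.1 * y.1, x.2.trans ((smulPath x.1 y.2).cast rfl (mul_smul _ _ _))⟩

/-- The action of `OrbitPath G k` on `π_l(C(k), e_k)`: `(σ, [p])` sends `[f]` to the class of `σ f`
with its basepoint `σ e_k` moved back to `e_k` along `p`. -/
noncomputable def orbitPathAct {k l : ℕ} (x : E.OrbitPath G k) (f : E.pil l k) : E.pil l k :=
  transportPi x.2 (smulPi x.1 f)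

/-- `x = (σ, [f])` is represented by the class `q` of paths from `η c` to `σ η c'`: completing `q`
by the images of linear paths at both ends gives `[f]`. The type of `q` does not mention `c`, `c'`
and `σ`, so that its endpoints need only be propositionally equal to `η c` and `σ η c'`. -/
def Represents {k : ℕ} (c c' : C10 k) {y y' : C.obj k} (q : Path.Homotopic.Quotient y y')
    (x : E.OrbitPath G k) : Prop :=
  ∃ q₀ : Path.Homotopic.Quotient (E.η k c) (x.1 • E.η k c'), SamePath q₀ q ∧
    SamePath x.2 ((E.lin (C10.std k) c).trans
      (q₀.trans (smulPath x.1 (E.lin c' (C10.std k)))))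

/-- `f` is represented by the class `φ` of spheres at the basepoint `η c`: the change of basepoint
along the image of a linear path takes `φ` to `f`. -/
def RepresentsPi {k : ℕ} (c : C10 k) {y : C.obj k} (φ : π_ l (C.obj k) y) (f : E.pil l k) : Prop :=
  ∃ φ₀ : π_ l (C.obj k) (E.η k c), SamePi φ₀ φ ∧ f = transportPi (E.lin (C10.std k) c) φ₀

section Lin

variable (ω : G k)

theorem smulPath_lin_trans_smulPath_lin (d₀ d₁ d₂ : C10 k) :
    (smulPath ω (E.lin d₀ d₁)).trans (smulPath ω (E.lin d₁ d₂)) = smulPath ω (E.lin d₀ d₂) := by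
  rw [← smulPath_trans, E.lin_trans]

theorem smulPath_lin_self (d : C10 k) : smulPath ω (E.lin d d) = .refl _ := by
  rw [E.lin_self, smulPath_refl]

theorem lin_trans_smulPath_lin (c₀ c₁ c₂ d₀ d₁ d₂ : C10 k)
    (q : Path.Homotopic.Quotient (E.η k c₂) (ω • E.η k d₀)) :
    ((E.lin c₀ c₁).trans ((E.lin c₁ c₂).trans (q.trans (smulPath ω (E.lin d₀ d₁))))).trans
      (smulPath ω (E.lin d₁ d₂)) =
      (E.lin c₀ c₂).trans (q.trans (smulPath ω (E.lin d₀ d₂))) := by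
  rw [← E.smulPath_lin_trans_smulPath_lin ω d₀ d₁ d₂, ← E.lin_trans c₀ c₁ c₂]
  simp only [Path.Homotopic.Quotient.trans_assoc]

theorem trans_smulPath_lin_trans (d₀ d₁ : C10 k) {x y z : C.obj k}
    (p : Path.Homotopic.Quotient x y) (q : Path.Homotopic.Quotient y (ω • E.η k d₀))
    (r : Path.Homotopic.Quotient (ω • E.η k d₀) z) :
    (p.trans (q.trans (smulPath ω (E.lin d₀ d₁)))).trans ((smulPath ω (E.lin d₁ d₀)).trans r) =
      p.trans (q.trans r) := by
  simp only [Path.Homotopic.Quotient.trans_assoc]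
  rw [← Path.Homotopic.Quotient.trans_assoc (smulPath ω (E.lin d₀ d₁)),
    E.smulPath_lin_trans_smulPath_lin, E.smulPath_lin_self, Path.Homotopic.Quotient.refl_trans]

theorem transportPi_trans_smulPath_lin (c₀ c₁ d₀ d₁ : C10 k)
    (q : Path.Homotopic.Quotient (E.η k c₁) (ω • E.η k d₀)) (f : π_ l (C.obj k) (ω • E.η k d₀)) :
    transportPi ((E.lin c₀ c₁).trans (q.trans (smulPath ω (E.lin d₀ d₁))))
      (transportPi (smulPath ω (E.lin d₁ d₀)) f) =
      transportPi (E.lin c₀ c₁) (transportPi q f) := by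
  rw [transportPi_trans, transportPi_trans, ← transportPi_trans (smulPath ω (E.lin d₀ d₁)),
    E.smulPath_lin_trans_smulPath_lin, E.smulPath_lin_self, transportPi_refl]

end Lin

variable {E}

theorem Represents.self (x : E.OrbitPath G k) :
    E.Represents (C10.std k) (C10.std k) x.2 x := by
  refine ⟨x.2, .refl _, .of_eq ?_⟩
  rw [E.smulPath_lin_self, E.lin_self]
  exact ((Path.Homotopic.Quotient.refl_trans _).trans (Path.Homotopic.Quotient.trans_refl _)).symm

theorem Represents.eq {c c' d d' : C10 k} {x y : E.OrbitPath G k} {a a' b b' : C.obj k}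
    {p : Path.Homotopic.Quotient a a'} {q : Path.Homotopic.Quotient b b'}
    (hx : E.Represents c c' p x) (hy : E.Represents d d' q y) (hσ : x.1 = y.1)
    (hc : c = d) (hc' : c' = d') (hpq : SamePath p q) : x = y := by
  subst hc hc'
  obtain ⟨σ, x⟩ := x
  obtain ⟨τ, y⟩ := y
  obtain rfl : σ = τ := hσ
  obtain ⟨p₀, hp, hx⟩ := hx
  obtain ⟨q₀, hq, hy⟩ := hy
  obtain rfl := ((hp.trans hpq).trans hq.symm).eq
  exact congrArg (Sigma.mk σ) (hx.trans hy.symm).eq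

theorem Represents.comp {c c' : C10 k} {d d' : ∀ i, C10 (m i)}
    {p : Path.Homotopic.Quotient a a'} {q : ∀ i, Path.Homotopic.Quotient (b i) (b' i)}
    {x : E.OrbitPath G k} {y : ∀ i, E.OrbitPath G (m i)} (hx : E.Represents c c' p x)
    (hy : ∀ i, E.Represents (d i) (d' i) (q i) (y i)) :
    E.Represents (C10.ops.comp m h c d)
      (C10.ops.comp (fun i => m ((π k x.1).unop.symm i)) (sum_perm_eq h _) c'
        (fun i => d' ((π k x.1).unop.symm i)))
      (C.pathCompQ m h p q) ((E.orbitPathOps hC).comp m h x y) := by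
  obtain ⟨p₀, hp, hx⟩ := hx
  choose q₀ hq hy using hy
  let ω := P.comp m h x.1 fun i => (y i).1
  let m' i := m ((π k x.1).unop.symm i)
  let h' := sum_perm_eq h (π k x.1).unop
  let γcd' := C10.ops.comp m' h' c' fun i => d' ((π k x.1).unop.symm i)
  have htarget : ω • E.η N γcd' =
      C.ops.comp m h (x.1 • E.η k c') (fun i => (y i).1 • E.η (m i) (d' i)) := by
    rw [E.map_comp]
    exact (hC.equivariant m h x.1 _ (E.η k c') (fun i => E.η (m i) (d' i))).symm
  have hcast := SamePath.cast (C.pathCompQ m h p₀ q₀) (E.map_comp m h c d) htarget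
  refine ⟨_, hcast.trans (TopOperad.samePath_pathCompQ m h hp hq), ?_⟩
  have hmid := TopOperad.samePath_pathCompQ m h hx hy
  rw [C.pathCompQ_trans, C.pathCompQ_trans] at hmid
  have hright := (hC.samePath_equivariant m h x.1 (fun i => (y i).1) (E.lin c' (C10.std k))
    (fun i => E.lin (d' i) (C10.std (m i)))).trans ((E.samePath_pathCompQ_lin m' h' _ _ _ _).smul ω)
  have hmid' := hmid.trans
    ((E.samePath_pathCompQ_lin m h _ _ _ _).concat (hcast.symm.concat hright))
  have hδ₂ := (E.samePath_δ m' h').reverse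
  rw [E.lin_symm] at hδ₂
  exact (((E.samePath_δ m h).concat hmid').concat ((SamePath.cast _ _ _).trans (hδ₂.smul ω))).trans
    (.of_eq (E.lin_trans_smulPath_lin ω _ _ _ _ _ _ _))

theorem Represents.one :
    E.Represents (C10.std 1) (C10.std 1) (Path.Homotopic.Quotient.refl C.ops.one)
      (E.orbitPathOps hC).one := by
  obtain ⟨q₀, hq, hone⟩ := Represents.self (E.orbitPathOps hC).one
  have hcast := SamePath.cast (Path.Homotopic.Quotient.refl (E.e 1)) rfl (one_smul (G 1) (E.e 1))
  have hrefl : SamePath (Path.Homotopic.Quotient.refl (E.e 1))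
      (Path.Homotopic.Quotient.refl C.ops.one) := .mk fun _ => E.map_one
  exact ⟨q₀, (hq.trans hcast).trans hrefl, hone⟩

theorem Represents.mul {c c' c'' : C10 k} {x x' : E.OrbitPath G k} {a₀ a₁ a₂ b₀ b₁ : C.obj k}
    {p : Path.Homotopic.Quotient a₀ a₁} {q : Path.Homotopic.Quotient b₀ b₁}
    {r : Path.Homotopic.Quotient a₁ a₂} (hx : E.Represents c c' p x)
    (hx' : E.Represents c' c'' q x') (hr : SamePath r (smulPath x.1 q)) :
    E.Represents c c'' (p.trans r) (E.orbitPathMul x x') := by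
  obtain ⟨p₀, hp, hx⟩ := hx
  obtain ⟨q₀, hq, hx'⟩ := hx'
  let std := C10.std k
  have hcast := SamePath.cast (smulPath x.1 q₀) rfl (mul_smul x.1 x'.1 (E.η k c''))
  refine ⟨p₀.trans _, hp.concat (hcast.trans ((hq.smul _).trans hr.symm)), ?_⟩
  have hσx' := (SamePath.cast _ rfl (mul_smul _ _ _)).trans (hx'.smul x.1)
  rw [smulPath_trans, smulPath_trans] at hσx'
  -- The linear paths between `η c'` and `e_k` in the middle cancel.
  have hcancel := E.trans_smulPath_lin_trans x.1 c' std (E.lin std c) p₀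
    ((smulPath x.1 q₀).trans (smulPath x.1 (smulPath x'.1 (E.lin c'' std))))
  have htail := (SamePath.refl p₀).concat
    (hcast.symm.concat (samePath_smulPath_smulPath x.1 x'.1 (E.lin c'' std)))
  refine ((hx.concat hσx').trans (.of_eq hcancel)).trans (.concat (.refl _) (htail.trans ?_))
  exact .of_eq (Path.Homotopic.Quotient.trans_assoc _ _ _).symm

theorem RepresentsPi.self (f : E.pil l k) : E.RepresentsPi (C10.std k) f f :=
  ⟨f, .refl _, by rw [E.lin_self]; exact (transportPi_refl f).symm⟩

theorem RepresentsPi.eq {c d : C10 k} {f g : E.pil l k} {a b : C.obj k}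
    {φ : π_ l (C.obj k) a} {ψ : π_ l (C.obj k) b} (hf : E.RepresentsPi c φ f)
    (hg : E.RepresentsPi d ψ g) (hc : c = d) (h : SamePi φ ψ) : f = g := by
  subst hc
  obtain ⟨φ₀, hφ, rfl⟩ := hf
  obtain ⟨ψ₀, hψ, rfl⟩ := hg
  rw [((hφ.trans h).trans hψ.symm).eq]

theorem RepresentsPi.comp {c : C10 k} {d : ∀ i, C10 (m i)} {φ : π_ l (C.obj k) a}
    {ψ : ∀ i, π_ l (C.obj (m i)) (b i)} {f : E.pil l k} {g : ∀ i, E.pil l (m i)}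
    (hf : E.RepresentsPi c φ f) (hg : ∀ i, E.RepresentsPi (d i) (ψ i) (g i)) :
    E.RepresentsPi (C10.ops.comp m h c d) (C.loopCompQ m h φ ψ) ((E.pilOps l).comp m h f g) := by
  obtain ⟨φ₀, hφ, rfl⟩ := hf
  choose ψ₀ hψ hg using hg
  obtain rfl : g = _ := funext hg
  obtain ⟨θ, hθ⟩ := SamePi.exists_of_eq (C.loopCompQ m h φ₀ ψ₀) (E.map_comp m h c d).symm
  refine ⟨θ, hθ.symm.trans (TopOperad.samePi_loopCompQ m h hφ hψ), SamePi.eq ?_⟩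
  rw [← E.lin_trans _ (C10.stdComp m h), transportPi_trans]
  change SamePi (transportPi (.mk (E.δ m h)) (C.loopCompQ m h _ _)) _
  refine .transport (E.samePath_δ m h) ?_
  refine (SamePi.of_eq (C.loopCompQ_transportPi m h _ _ _ _)).trans ?_
  exact .transport (E.samePath_pathCompQ_lin m h _ _ _ _) hθ

theorem RepresentsPi.one :
    E.RepresentsPi (C10.std 1)
      (Quotient.mk _ (GenLoop.const : GenLoop (Fin l) _ C.ops.one)) (E.pilOps l).one := by
  obtain ⟨φ₀, hφ, hone⟩ := RepresentsPi.self (E.pilOps l).one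
  exact ⟨φ₀, hφ.trans (.mk E.map_one fun _ => E.map_one), hone⟩

theorem RepresentsPi.act {c c' : C10 k} {x : E.OrbitPath G k} {f : E.pil l k}
    {a₀ a₁ b₀ : C.obj k} {p : Path.Homotopic.Quotient a₀ a₁} {φ : π_ l (C.obj k) b₀}
    {θ : π_ l (C.obj k) a₁} (hx : E.Represents c c' p x) (hf : E.RepresentsPi c' φ f)
    (hθ : SamePi θ (smulPi x.1 φ)) :
    E.RepresentsPi c (transportPi p θ) (E.orbitPathAct x f) := by
  obtain ⟨p₀, hp, hx⟩ := hx
  obtain ⟨φ₀, hφ, rfl⟩ := hf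
  refine ⟨transportPi p₀ (smulPi x.1 φ₀), .transport hp ((hφ.smul _).trans hθ.symm), SamePi.eq ?_⟩
  refine (SamePi.transport hx (.of_eq (smulPi_transportPi _ _ _))).trans (.of_eq ?_)
  exact E.transportPi_trans_smulPath_lin x.1 (C10.std k) c c' (C10.std k) p₀ (smulPi x.1 φ₀)

variable (E) (hP : IsGroupOperad P π)

include hP in
theorem isOperad_orbitPathOps : (E.orbitPathOps hC).IsOperad where
  zero_unique := by
    obtain ⟨_⟩ := hP.isOperad.zero_unique
    obtain ⟨_⟩ := C.isOperad.zero_unique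
    refine ⟨⟨⟨1, (Path.Homotopic.Quotient.refl (E.e 0)).cast rfl (one_smul _ _)⟩, fun x => ?_⟩⟩
    exact (Represents.self x).eq (.self _) (Subsingleton.elim _ _) rfl rfl
      (SamePath.iff_exists_eq_cast.2 ⟨rfl, Subsingleton.elim _ _, Subsingleton.elim _ _⟩)
  assoc m N h n M hM s hs hM' x y z :=
    (Represents.comp hC n hM (.comp hC m h (.self x) fun i => .self (y i)) fun p => .self (z p)).eq
      (.comp hC s hM' (.self x) fun i => .comp hC _ (hs i) (.self (y i))
        fun j => .self (z (blk m h ⟨i, j⟩)))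
      (hP.isOperad.assoc m h n hM s hs hM' _ _ _)
      (C10.isOperad_ops.assoc m h n hM s hs hM' _ _ _)
      (C10.comp_stdComp_std (hP.map_comp m h x.1 fun i => (y i).1) hM hs hM')
      (C.samePath_assoc m h n hM s hs hM' _ _ _)
  one_comp h x := by
    have hσ := hP.isOperad.one_comp h x.1
    rw [hP.unit_eq] at hσ
    exact (Represents.comp hC _ h (.one hC) fun _ => .self x).eq (.self x) hσ
      (C10.isOperad_ops.one_comp h _) (C10.isOperad_ops.one_comp h _) (C.samePath_one_comp h _)
  comp_one h x := by
    have hσ := hP.isOperad.comp_one h x.1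
    rw [hP.unit_eq] at hσ
    exact (Represents.comp hC _ h (.self x) fun _ => .one hC).eq (.self x) hσ
      (C10.isOperad_ops.comp_one h _) (C10.isOperad_ops.comp_one h _) (C.samePath_comp_one h _)

include hP in
theorem orbitPathOps_crossed (x x' : E.OrbitPath G k) (y y' : ∀ i, E.OrbitPath G (m i)) :
    (E.orbitPathOps hC).comp m h (E.orbitPathMul x x') (fun i => E.orbitPathMul (y i) (y' i)) =
      E.orbitPathMul ((E.orbitPathOps hC).comp m h x y)
        ((E.orbitPathOps hC).comp (fun i => m ((π k x.1).unop.symm i)) (sum_perm_eq h _) x'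
          (fun i => y' ((π k x.1).unop.symm i))) := by
  have hleft := Represents.comp hC m h (.self (E.orbitPathMul x x'))
    fun i => .self (E.orbitPathMul (y i) (y' i))
  have hmid : SamePath
      (C.pathCompQ m h ((smulPath x.1 x'.2).cast rfl (mul_smul x.1 x'.1 (E.e k)))
        (fun i => (smulPath (y i).1 (y' i).2).cast rfl (mul_smul (y i).1 (y' i).1 (E.e (m i)))))
      (smulPath (P.comp m h x.1 fun i => (y i).1) (C.pathCompQ
        (fun i => m ((π k x.1).unop.symm i)) (sum_perm_eq h _) x'.2
        (fun i => (y' ((π k x.1).unop.symm i)).2))) :=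
    (TopOperad.samePath_pathCompQ m h (.cast _ _ _) fun _ => .cast _ _ _).trans
      (hC.samePath_equivariant m h _ _ _ _)
  have hright := Represents.mul (.comp hC m h (.self x) fun i => .self (y i))
    (.comp hC (fun i => m ((π k x.1).unop.symm i)) (sum_perm_eq h _) (.self x')
      fun i => .self (y' ((π k x.1).unop.symm i))) hmid
  refine hleft.eq hright (hP.crossed m h x.1 x'.1 (fun i => (y i).1) (fun i => (y' i).1)) rfl ?_
    (.of_eq (C.pathCompQ_trans m h _ _ _ _))
  refine C10.stdComp_congr (fun i => ?_) _ _
  change m ((π k (x.1 * x'.1)).unop.symm i) = _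
  rw [hP.map_mul]
  rfl

theorem isOperad_pilOps (l : ℕ) : (E.pilOps l).IsOperad where
  zero_unique := by
    obtain ⟨_⟩ := C.isOperad.zero_unique
    have := subsingleton_pi l (E.e 0)
    exact ⟨⟨⟨Quotient.mk _ GenLoop.const⟩, fun _ => Subsingleton.elim _ _⟩⟩
  assoc m N h n M hM s hs hM' x y z :=
    (RepresentsPi.comp n hM (.comp m h (.self x) fun i => .self (y i)) fun p => .self (z p)).eq
      (.comp s hM' (.self x) fun i => .comp _ (hs i) (.self (y i))
        fun j => .self (z (blk m h ⟨i, j⟩)))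
      (C10.isOperad_ops.assoc m h n hM s hs hM' _ _ _) (C.samePi_assoc m h n hM s hs hM' _ _ _)
  one_comp h x := (RepresentsPi.comp _ h .one fun _ => .self x).eq (.self x)
    (C10.isOperad_ops.one_comp h _) (C.samePi_one_comp h _)
  comp_one h x := (RepresentsPi.comp _ h (.self x) fun _ => .one).eq (.self x)
    (C10.isOperad_ops.comp_one h _) (C.samePi_comp_one h _)

theorem pilOps_equivariant (x : E.OrbitPath G k) (y : ∀ i, E.OrbitPath G (m i))
    (f : E.pil l k) (g : ∀ i, E.pil l (m i)) :
    (E.pilOps l).comp m h (E.orbitPathAct x f) (fun i => E.orbitPathAct (y i) (g i)) =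
      E.orbitPathAct ((E.orbitPathOps hC).comp m h x y)
        ((E.pilOps l).comp (fun i => m ((π k x.1).unop.symm i)) (sum_perm_eq h _) f
          (fun i => g ((π k x.1).unop.symm i))) :=
  (RepresentsPi.comp m h (.self _) fun _ => .self _).eq
    (.act (.comp hC m h (.self x) fun i => .self (y i))
      (.comp (fun i => m ((π k x.1).unop.symm i)) (sum_perm_eq h _) (.self f)
        fun i => .self (g ((π k x.1).unop.symm i)))
      (hC.samePi_equivariant m h x.1 (fun i => (y i).1) f g)) rfl
    (.of_eq (C.loopCompQ_transportPi m h _ _ _ _))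

theorem orbitPathMul_one_one :
    E.orbitPathMul (E.orbitPathOps hC).one (E.orbitPathOps hC).one = (E.orbitPathOps hC).one := by
  have hsmul : SamePath (Path.Homotopic.Quotient.refl C.ops.one)
      (smulPath (1 : G 1) (Path.Homotopic.Quotient.refl C.ops.one)) := by
    rw [smulPath_refl, one_smul]
    exact .refl _
  exact (Represents.mul (.one hC) (.one hC) hsmul).eq (.one hC) (one_mul 1) rfl rfl
    (.of_eq (Path.Homotopic.Quotient.refl_trans _))

variable {H : ℕ → Type v} [∀ n, Group (H n)] (φ : ∀ n, E.OrbitPath G n ≃ H n)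
  (hφ : ∀ n x y, φ n (E.orbitPathMul x y) = φ n x * φ n y)

include hφ in
theorem symm_mul_eq_orbitPathMul {n : ℕ} (a b : H n) :
    (φ n).symm (a * b) = E.orbitPathMul ((φ n).symm a) ((φ n).symm b) := by
  rw [Equiv.symm_apply_eq, hφ, Equiv.apply_symm_apply, Equiv.apply_symm_apply]

include hP hφ in
theorem isGroupOperad_transport_orbitPathOps :
    IsGroupOperad ((E.orbitPathOps hC).transport φ) (fun k a => π k ((φ k).symm a).1) where
  isOperad := (E.isOperad_orbitPathOps hC hP).transport φ
  map_mul a b := by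
    rw [E.symm_mul_eq_orbitPathMul φ hφ]
    exact hP.map_mul _ _
  map_unit := by
    simp only [OperadOps.transport, Equiv.symm_apply_apply, ← hP.map_unit, hP.unit_eq]
    rfl
  map_comp m N h a b := by
    simp only [OperadOps.transport, Equiv.symm_apply_apply]
    exact hP.map_comp m h _ _
  unit_eq := by
    have hidem := hφ 1 (E.orbitPathOps hC).one (E.orbitPathOps hC).one
    rw [E.orbitPathMul_one_one hC] at hidem
    exact mul_eq_left.1 hidem.symm
  crossed m N h a a' b b' := by
    simp only [OperadOps.transport, E.symm_mul_eq_orbitPathMul φ hφ]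
    rw [E.orbitPathOps_crossed hC m h hP, hφ]

theorem isGOperad_transport_pilOps {Y : ℕ → Type*} (ψ : ∀ n, E.pil l n ≃ Y n)
    (act : ∀ n, H n → Y n → Y n) (one_act : ∀ n x, act n 1 x = x)
    (mul_act : ∀ n a b x, act n (a * b) x = act n a (act n b x))
    (hact : ∀ n x f, act n (φ n x) (ψ n f) = ψ n (E.orbitPathAct x f)) :
    IsGOperad ((E.orbitPathOps hC).transport φ) (fun k a => π k ((φ k).symm a).1)
      ((E.pilOps l).transport ψ) act where
  isOperad := (E.isOperad_pilOps l).transport ψ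
  one_act := one_act _
  mul_act := mul_act _
  equivariant m N h σ τ a b := by
    have hsymm : ∀ n (σ : H n) (a : Y n),
        (ψ n).symm (act n σ a) = E.orbitPathAct ((φ n).symm σ) ((ψ n).symm a) := fun n σ a => by
      rw [Equiv.symm_apply_eq, ← hact, Equiv.apply_symm_apply, Equiv.apply_symm_apply]
    simp only [OperadOps.transport, hsymm, hact]
    rw [E.pilOps_equivariant hC m h]

end GoodBasepoint

end Action

/-! ### Covering maps and homotopy groups -/

section Covering

theorem isPathConnected_cubeBoundary (N : Type*) [Nontrivial N] :
    IsPathConnected (Cube.boundary N) := by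
  classical
  obtain ⟨i₀, -⟩ := exists_pair_ne N
  refine ⟨0, ⟨i₀, .inl rfl⟩, fun {t} ⟨i, hi⟩ => ?_⟩
  obtain ⟨j, hji⟩ := exists_ne i
  have h_edge : JoinedIn (Cube.boundary N) 0 (Pi.single i (t i)) :=
    ⟨⟨⟨fun r => Pi.single i (r * t i), (continuous_single i).comp (by fun_prop)⟩, by simp,
      by simp⟩, fun r => ⟨j, .inl (Pi.single_eq_of_ne hji _)⟩⟩
  have h_face : JoinedIn (Cube.boundary N) (Pi.single i (t i)) t := by
    refine ⟨⟨⟨fun r => Function.update (fun a => r * t a) i (t i), by fun_prop⟩,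
      by simp [Pi.single, Pi.zero_def], by simp⟩, fun r => ⟨i, ?_⟩⟩
    change Function.update (fun a => r * t a) i (t i) i = 0 ∨
      Function.update (fun a => r * t a) i (t i) i = 1
    rwa [Function.update_self]
  exact h_edge.trans h_face

variable {X : Type u} {Y : Type v} [TopologicalSpace X] [TopologicalSpace Y] {p : C(X, Y)} {l : ℕ}

theorem exists_lift_cube_of_isCoveringMap (cov : IsCoveringMap p) {N : Type*} [Finite N]
    (g : C(N → unitInterval, Y)) {x : X} {a : N → unitInterval} (hx : p x = g a) :
    ∃ G : C(N → unitInterval, X), G a = x ∧ ∀ t, p (G t) = g t := by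
  have : Fintype N := Fintype.ofFinite N
  -- `ℝ^N`, of which the cube is a retract, is simply connected and locally path-connected.
  let proj : C(N → ℝ, N → unitInterval) :=
    ⟨fun t i => Set.projIcc 0 1 zero_le_one (t i), by fun_prop⟩
  let incl : C(N → unitInterval, N → ℝ) := ⟨fun t i => t i, by fun_prop⟩
  have hproj : ∀ t, proj (incl t) = t := fun t =>
    funext fun i => Set.projIcc_val zero_le_one (t i)
  obtain ⟨F, ⟨hFa, hF⟩, -⟩ := cov.existsUnique_continuousMap_lifts (g.comp proj) (incl a) x
    (hx.trans (congrArg g (hproj a).symm))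
  exact ⟨F.comp incl, hFa, fun t => (congrFun hF (incl t)).trans (congrArg g (hproj t))⟩

theorem injective_piMap_of_isCoveringMap (cov : IsCoveringMap p) (hl : 1 ≤ l) (x : X) :
    Function.Injective (piMap (l := l) p x) := by
  intro f g hfg
  obtain ⟨f, rfl⟩ := exists_genLoop_mk f
  obtain ⟨g, rfl⟩ := exists_genLoop_mk g
  have h0 : 0 ∈ Cube.boundary (Fin l) := ⟨⟨0, hl⟩, Or.inl rfl⟩
  have hfg0 : f 0 = g 0 := (f.2 _ h0).trans (g.2 _ h0).symm
  exact Quotient.sound ((cov.homotopicRel_iff_comp ⟨0, h0, hfg0⟩).2 (Quotient.exact hfg))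

theorem surjective_piMap_of_isCoveringMap (cov : IsCoveringMap p) (hl : 2 ≤ l) (x : X) :
    Function.Surjective (piMap (l := l) p x) := by
  intro g
  obtain ⟨g, rfl⟩ := exists_genLoop_mk g
  have : Nontrivial (Fin l) := Fin.nontrivial_iff_two_le.2 hl
  have h0 : 0 ∈ Cube.boundary (Fin l) := ⟨⟨0, by omega⟩, Or.inl rfl⟩
  obtain ⟨G, hG0, hG⟩ := exists_lift_cube_of_isCoveringMap cov g.1 (g.2 0 h0).symm
  -- As `2 ≤ l`, the boundary of the cube is connected, and the lift of a constant map is constant.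
  have hboundary : ∀ t ∈ Cube.boundary (Fin l), G t = x := fun t ht => by
    rw [← hG0]
    refine cov.constOn_of_comp (isPathConnected_cubeBoundary (Fin l)).isConnected.isPreconnected
      G.continuous.continuousOn (fun s hs s' hs' => ?_) ht h0
    rw [hG, hG]
    exact (g.2 s hs).trans (g.2 s' hs').symm
  exact ⟨Quotient.mk _ ⟨G, hboundary⟩, congrArg (Quotient.mk _) (GenLoop.ext _ _ hG)⟩

end Covering

/-! ### The covering of the orbit space -/

namespace SymmTopOperad

variable {C : SymmTopOperad.{u}}

theorem IsCovering.isQuotientCoveringMap (hcov : C.IsCovering) (k : ℕ) :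
    IsQuotientCoveringMap (C.quot k) (SG k) where
  toIsQuotientMap := isQuotientMap_quotient_mk'
  toContinuousConstSMul := inferInstance
  apply_eq_iff_mem_orbit := Quotient.eq''
  disjoint := hcov k

variable (E : GoodBasepoint C.toTopOperad) {k l : ℕ}

theorem samePath_projPi1 (x : C.liftedPi1 E k) :
    SamePath (C.projPi1 E k x) (x.2.map (C.quot k)) := SamePath.cast _ _ _

theorem samePath_map_quot_smulPath {x y : C.obj k} (σ : SG k) (p : Path.Homotopic.Quotient x y) :
    SamePath ((smulPath σ p).map (C.quot k)) (p.map (C.quot k)) := by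
  obtain ⟨p, rfl⟩ := Path.Homotopic.Quotient.mk_surjective p
  exact .mk fun t => C.quot_smul σ (p t)

theorem samePi_piMap_quot_smulPi {x : C.obj k} (σ : SG k) (f : π_ l (C.obj k) x) :
    SamePi (piMap (C.quot k) _ (smulPi σ f)) (piMap (C.quot k) _ f) := by
  obtain ⟨f, rfl⟩ := exists_genLoop_mk f
  exact .mk (C.quot_smul σ x) fun t => C.quot_smul σ (f t)

theorem projPi1_orbitPathMul (x y : C.liftedPi1 E k) :
    C.projPi1 E k (E.orbitPathMul x y) = C.projPi1 E k x * C.projPi1 E k y := by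
  have hright : SamePath (((smulPath x.1 y.2).cast rfl (mul_smul _ _ _)).map (C.quot k))
      (C.projPi1 E k y) :=
    ((SamePath.cast _ rfl _).map _).trans
      ((samePath_map_quot_smulPath x.1 y.2).trans (samePath_projPi1 E y).symm)
  have hmap := (samePath_projPi1 E (E.orbitPathMul x y)).trans
    (.of_eq (quotient_map_trans x.2 _ _))
  exact (hmap.trans (.concat (samePath_projPi1 E x).symm hright)).eq

theorem piAct_projPi1_piMap (x : C.liftedPi1 E k) (f : E.pil l k) :
    piAct (C.projPi1 E k x) (piMap (C.quot k) (E.e k) f) =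
      piMap (C.quot k) (E.e k) (E.orbitPathAct x f) := by
  rw [GoodBasepoint.orbitPathAct, piMap_transportPi]
  exact SamePi.eq (.transport (samePath_projPi1 E x) (samePi_piMap_quot_smulPi x.1 f).symm)

theorem IsCovering.injective_projPi1 (hcov : C.IsCovering) :
    Function.Injective (C.projPi1 E k) := by
  have hq := hcov.isQuotientCoveringMap k
  have cov := hq.isCoveringMap
  intro x y hxy
  have hmon : ∀ z : C.liftedPi1 E k, cov.monodromy (C.projPi1 E k z) ⟨E.e k, rfl⟩ =
      ⟨z.1 • E.e k, C.quot_smul z.1 (E.e k)⟩ := fun z => by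
    refine cov.monodromy_eq_of_map_eq z.2 ?_
    exact ((SamePath.cast _ _ _).trans (samePath_projPi1 E z)).symm.eq
  have hsmul : x.1 • E.e k = y.1 • E.e k :=
    congrArg Subtype.val ((hmon x).symm.trans ((congrArg (cov.monodromy · _) hxy).trans (hmon y)))
  have := hq.isCancelSMul
  obtain ⟨σ, x⟩ := x
  obtain ⟨τ, y⟩ := y
  obtain rfl : σ = τ := IsCancelSMul.right_cancel _ _ _ hsmul
  refine congrArg (Sigma.mk σ) (cov.injective_path_homotopic_map _ _ ?_)
  exact ((samePath_projPi1 E ⟨σ, x⟩).symm.trans ((SamePath.of_eq hxy).trans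
    (samePath_projPi1 E ⟨σ, y⟩))).eq

theorem IsCovering.surjective_projPi1 (hcov : C.IsCovering) :
    Function.Surjective (C.projPi1 E k) := by
  have hq := hcov.isQuotientCoveringMap k
  have cov := hq.isCoveringMap
  intro γ
  let b : C.quot k ⁻¹' {C.quot k (E.e k)} := ⟨E.e k, rfl⟩
  obtain ⟨σ, hσ⟩ := hq.apply_eq_iff_mem_orbit.1 (cov.monodromy γ b).2
  refine ⟨⟨σ, (cov.liftPathQuotient γ b).cast rfl hσ⟩, SamePath.eq ?_⟩
  refine (samePath_projPi1 E _).trans (((SamePath.cast _ rfl hσ).map _).trans ?_)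
  exact (SamePath.of_eq (cov.map_liftPathQuotient γ b)).trans (SamePath.cast _ _ _)

/-- The bijection `L_k ≃ π₁(C(k)/S_k, S_k e_k)` induced by the quotient map. -/
noncomputable def IsCovering.projPi1Equiv (hcov : C.IsCovering) (k : ℕ) :
    C.liftedPi1 E k ≃ C.pi1 E k :=
  .ofBijective (C.projPi1 E k) ⟨hcov.injective_projPi1 E, hcov.surjective_projPi1 E⟩

/-- The bijection `π_l(C(k), e_k) ≃ π_l(C(k)/S_k, S_k e_k)` induced by the quotient map for
`l > 1`. -/
noncomputable def IsCovering.piMapEquiv (hcov : C.IsCovering) (hl : 1 < l) (k : ℕ) :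
    E.pil l k ≃ C.pil E l k :=
  have cov := (hcov.isQuotientCoveringMap k).isCoveringMap
  .ofBijective (piMap (C.quot k) (E.e k)) ⟨injective_piMap_of_isCoveringMap cov hl.le _,
    surjective_piMap_of_isCoveringMap cov hl _⟩

theorem IsCovering.isGroupOperad_pi1 (hcov : C.IsCovering) :
    IsGroupOperad ((C.liftedPi1Ops E).transport (hcov.projPi1Equiv E))
      (fun k a => ((hcov.projPi1Equiv E k).symm a).1) :=
  E.isGroupOperad_transport_orbitPathOps C.isGOperad isGroupOperad_symOps _
    fun _ => projPi1_orbitPathMul E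

theorem IsCovering.isGOperad_pil (hcov : C.IsCovering) (hl : 1 < l) :
    IsGOperad ((C.liftedPi1Ops E).transport (hcov.projPi1Equiv E))
      (fun k a => ((hcov.projPi1Equiv E k).symm a).1)
      ((E.pilOps l).transport (hcov.piMapEquiv E hl)) (fun _ a f => piAct a f) :=
  E.isGOperad_transport_pilOps C.isGOperad _ _ _ (fun _ => transportPi_refl)
    (fun _ => transportPi_trans) fun _ => piAct_projPi1_piMap E

end SymmTopOperad

/-! ### The group operad without symmetries -/

namespace TrivialAction

/-- The operad of trivial groups, which acts on every operad: this case of the construction of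
`orbitPathOps` gives the fundamental groups of a nonsymmetric operad. -/
def ops : OperadOps fun _ => Unit where
  comp _ _ _ _ _ := ()
  one := ()

theorem isGroupOperad_ops : IsGroupOperad ops (fun _ _ => 1) where
  isOperad :=
    { zero_unique := ⟨inferInstance⟩
      assoc := fun _ _ _ _ _ _ _ _ _ _ _ _ => rfl
      one_comp := fun _ _ => rfl
      comp_one := fun _ _ => rfl }
  map_mul _ _ := (one_mul _).symm
  map_unit := rfl
  map_comp m _ h _ _ := (symComp_one m h).symm
  unit_eq := rfl
  crossed _ _ _ _ _ _ _ := rfl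

/-- The action of the trivial group on a type. -/
abbrev mulAction (X : Type*) : MulAction Unit X where
  smul _ x := x
  one_smul _ := rfl
  mul_smul _ _ _ := rfl

attribute [local instance] mulAction

theorem continuousConstSMul (X : Type*) [TopologicalSpace X] : ContinuousConstSMul Unit X :=
  ⟨fun _ => continuous_id⟩

attribute [local instance] continuousConstSMul

theorem isGOperad (C : TopOperad.{u}) :
    IsGOperad ops (fun _ _ => 1) C.ops (fun n (σ : Unit) (x : C.obj n) => σ • x) where
  isOperad := C.isOperad
  one_act _ := rfl
  mul_act _ _ _ := rfl
  equivariant _ _ _ _ _ _ _ := rfl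

variable {C : TopOperad.{u}} (E : GoodBasepoint C)

/-- For the trivial group, paths from `e_k` to points of its orbit are loops. -/
def orbitPathEquiv (k : ℕ) : E.OrbitPath (fun _ => Unit) k ≃ E.pi1 k where
  toFun x := x.2
  invFun p := ⟨(), p⟩
  left_inv _ := rfl
  right_inv _ := rfl

theorem samePath_smulPath {k : ℕ} {x y : C.obj k} (σ : Unit) (p : Path.Homotopic.Quotient x y) :
    SamePath (smulPath σ p) p := SamePath.map_of_forall_eq p fun _ => rfl

theorem orbitPathEquiv_mul (k : ℕ) (x y : E.OrbitPath (fun _ => Unit) k) :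
    orbitPathEquiv E k (E.orbitPathMul x y) = orbitPathEquiv E k x * orbitPathEquiv E k y :=
  SamePath.eq (.concat (.refl x.2) ((SamePath.cast _ _ _).trans (samePath_smulPath _ _)))

theorem transport_orbitPathOps :
    (E.orbitPathOps (isGOperad C)).transport (orbitPathEquiv E) = E.pi1Ops := by
  refine OperadOps.transport_eq_of_map _ (SamePath.cast (.refl (E.e 1)) rfl rfl).eq
    fun m N h f g => ?_
  let p := (Path.Homotopic.Quotient.mk (E.δ m h)).trans (C.pathCompQ m h f.2 fun i => (g i).2)
  have hδ := samePath_smulPath () (Path.Homotopic.Quotient.mk (E.δ m h)).symm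
  exact SamePath.eq (.concat (.refl p) ((SamePath.cast _ rfl rfl).trans hδ))

theorem isGroupOperad_pi1Ops : IsGroupOperad E.pi1Ops (fun _ _ => 1) := by
  rw [← transport_orbitPathOps]
  exact E.isGroupOperad_transport_orbitPathOps (isGOperad C) isGroupOperad_ops (orbitPathEquiv E)
    (orbitPathEquiv_mul E)

theorem piAct_orbitPathEquiv {k l : ℕ} (x : E.OrbitPath (fun _ => Unit) k) (f : E.pil l k) :
    piAct (orbitPathEquiv E k x) f = E.orbitPathAct x f :=
  SamePi.eq (.transport (.refl x.2) (SamePi.map_of_forall_eq f fun _ => rfl).symm)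

theorem isGOperad_pilOps (l : ℕ) :
    IsGOperad E.pi1Ops (fun _ _ => 1) (E.pilOps l) (fun _ a f => piAct a f) := by
  rw [← transport_orbitPathOps]
  exact E.isGOperad_transport_pilOps (isGOperad C) (orbitPathEquiv E) (fun _ => Equiv.refl _) _
    (fun _ => transportPi_refl) (fun _ => transportPi_trans) fun _ => piAct_orbitPathEquiv E

end TrivialAction

theorem mainTheorem8_general :
    (∀ (C : TopOperad.{u}) (E : GoodBasepoint C),
      IsGroupOperad E.pi1Ops (fun _ _ => 1) ∧
      ∀ l : ℕ, IsGOperad E.pi1Ops (fun _ _ => 1) (E.pilOps l) (fun _ a f => piAct a f)) ∧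
    (∀ (C : SymmTopOperad.{u}) (E : GoodBasepoint C.toTopOperad), C.IsCovering →
      ∃ φ : ∀ k, C.liftedPi1 E k ≃ C.pi1 E k,
        (∀ k x, φ k x = C.projPi1 E k x) ∧
        IsGroupOperad ((C.liftedPi1Ops E).transport φ) (fun k a => ((φ k).symm a).1) ∧
        ∀ l : ℕ, 1 < l →
          ∃ ψ : ∀ k, E.pil l k ≃ C.pil E l k,
            (∀ k x, ψ k x = piMap (C.quot k) (E.e k) x) ∧
            IsGOperad ((C.liftedPi1Ops E).transport φ) (fun k a => ((φ k).symm a).1)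
              ((E.pilOps l).transport ψ) (fun _ a f => piAct a f)) :=
  ⟨fun _ E => ⟨TrivialAction.isGroupOperad_pi1Ops E, TrivialAction.isGOperad_pilOps E⟩,
    fun _ E hcov => ⟨hcov.projPi1Equiv E, fun _ _ => rfl, hcov.isGroupOperad_pi1 E,
      fun _ hl => ⟨hcov.piMapEquiv E hl, fun _ _ => rfl, hcov.isGOperad_pil E hl⟩⟩⟩

theorem mainTheorem8 :
    (∀ (C : TopOperad.{u}) (E : GoodBasepoint C), C.IsPathConnected →
      IsGroupOperad E.pi1Ops (fun _ _ => 1) ∧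
      ∀ l : ℕ, 1 ≤ l →
        IsGOperad E.pi1Ops (fun _ _ => 1) (E.pilOps l) (fun _ a f => piAct a f)) ∧
    (∀ (C : SymmTopOperad.{u}) (E : GoodBasepoint C.toTopOperad), C.IsPathConnected →
      C.IsCovering →
      ∃ φ : ∀ k, C.liftedPi1 E k ≃ C.pi1 E k,
        (∀ k x, φ k x = C.projPi1 E k x) ∧
        IsGroupOperad ((C.liftedPi1Ops E).transport φ) (fun k a => ((φ k).symm a).1) ∧
        ∀ l : ℕ, 1 < l →
          ∃ ψ : ∀ k, E.pil l k ≃ C.pil E l k,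
            (∀ k x, ψ k x = piMap (C.quot k) (E.e k) x) ∧
            IsGOperad ((C.liftedPi1Ops E).transport φ) (fun k a => ((φ k).symm a).1)
              ((E.pilOps l).transport ψ) (fun _ a f => piAct a f)) :=
  ⟨fun C E _ => ⟨(mainTheorem8_general.1 C E).1, fun l _ => (mainTheorem8_general.1 C E).2 l⟩,
    fun C E _ hcov => mainTheorem8_general.2 C E hcov⟩
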